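/- **Setting.** Interest rates are zero; withdrawals take place at dates $t=1,\dots,N$. Under the pricing measure $\mathbb Q$ the asset price $(S_t)$, $S_0=1$, is a nonnegative martingale for a filtration $(\mathcal F_t)$. Assume * (A1) for $t<N$, $S$ is Markov with transition kernel $\kappa_t(s,\cdot)$ from $t$ to $t+1$, carried by $[0,\infty)$ for $s\ge 0$, and for $s>0$ the law $\kappa_t(s,\cdot)$ is absolutely continuous on $(0,\infty)$ (an atom at $0$ is allowed); * (A2) $P_t(aK\,|\,as)=a\,P_t(K\,|\,s)$ for all $t<N$ and $a,K,s>0$, where $P_t(K|x)=\int (K-y)^+\kappa_t(x,dy)$ and $C_t(K|x)=\int (y-K)^+\kappa_t(x,dy)$ are the one-period put and call values; $\Delta^P_t,\Delta^C_t$ denote their first derivatives and $\Gamma_t(K|x)$ the second derivative of the put with respect to the spot $x$. Let $A_1,\dots,A_{N-1}>0$ be a guarantee base (formally $A_N=\infty$), $X_0>0$, $w_0>0$, $X_{t+1}=X_tS_{t+1}/S_t-w_t$, $w_t=\max(w_{t-1},X_t/A_t)$ for $1\le t\le N-1$, $w_N=w_{N-1}$, $\tau=\inf\{t\le N:X_t\le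 0\}$, $Z^{(0)}=0$, $Z^{(t)}=w_{t-1}1_{\tau\le t-1}+X_t^-1_{\tau=t}$, and $V_t=\mathbb E^{\mathbb Q}[\sum_{u=t}^N Z^{(u)}\,|\,\mathcal F_t]$. Define backwards for $t\le N$ the value function (when $\tau\ge t$) $$V^R_t(w,x)=\begin{cases}(N-t)w-x,& x\le 0,\\ \bar V^R_t(\max(w,x/A_t),x),& x>0,\ t<N,\\ 0,& x>0,\ t=N,\end{cases}$$ $$\bar V^R_t(w,x)=\mathbb E^{\mathbb Q}\big[V^R_{t+1}(w,\,xS_{t+1}/S_t-w)\,\big|\,S_t=s\big]\quad(t<N),$$ where the values may a priori also depend on the asset price $s=S_t$. Define backwards $\alpha_{N-1}=\beta_{N-1}=0$, $g^R_{N-1}(k)\,dk=\delta_1(dk)$ and, for $t\le N-2$, with $a=A_{t+1}$ and $b=1+A_{t+2}$, $$\alpha_t=\alpha_{t+1}\Big[1+\tfrac{C_{t+1}(b|a)}{A_{t+2}}\Big]+\beta_{t+1}P_{t+1}(b|a)+\int_1^{b}P_{t+1}(k|a)\,g^R_{t+1}(k)\,dk,$$ $$\beta_t=-\Big[\tfrac{\alpha_{t+1}}{A_{t+2}}\Delta^C_{t+1}(b|a)+\beta_{t+1}\Delta^P_{t+1}(b|a)+\int_1^{b}\Delta^P_{t+1}(k|a)\,g^R_{t+1}(k)\,dk\Big],$$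 $$g^R_t(k)=\Big(\tfrac{\alpha_{t+1}}{A_{t+2}}+\beta_{t+1}\Big)\Gamma_{t+1}(b|k-1)+\int_1^{b}\Gamma_{t+1}(k'|k-1)\,g^R_{t+1}(k')\,dk',\qquad k\in[1,1+A_{t+1}].$$ **Theorem.** The put and call values are differentiable in the spot $x>0$, and twice differentiable for almost every $x>0$. For $t\le N-2$ the function $g^R_t$ is integrable on $[1,1+A_{t+1}]$, and so are $k\mapsto P_t(wk|x)g^R_t(k)$ and $k\mapsto\Delta^P_t(wk|x)g^R_t(k)$ for all $w,x>0$, and $k\mapsto\Gamma_t(k|x)g^R_t(k)$ for almost every $x>0$. For every $t=0,\dots,N-1$: 1. For all $w,x,s>0$ the expectation defining $\bar V^R_t$ exists, does not depend on $s$, and $$\bar V^R_t(w,x)=\alpha_t\Big[w+\tfrac{C_t(w(1+A_{t+1})|x)}{A_{t+1}}\Big]+\beta_tP_t(w(1+A_{t+1})|x)+\int_1^{1+A_{t+1}}P_t(wk|x)\,g^R_t(k)\,dk;$$ for $t=N-1$ the right-hand side is $P_{N-1}(w|x)$. 2. $\bar V^R_t(cw,cx)=c\,\bar V^R_t(w,x)$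 for all $c,w,x>0$. 3. (Replication) For all $w>0$ and $y\ge 0$ the payoff at date $t+1$ of the portfolio in 1, at fund value $y$ before the withdrawal, equals $V^R_{t+1}(w,y-w)$: $$\alpha_t\Big[w+\tfrac{(y-w(1+A_{t+1}))^+}{A_{t+1}}\Big]+\beta_t(w(1+A_{t+1})-y)^++\int_1^{1+A_{t+1}}(wk-y)^+g^R_t(k)\,dk=V^R_{t+1}(w,y-w).$$ 4. The claims $Z^{(u)}$, $u\le N$, are integrable. Almost surely on $\{\tau>t\}$, $V_t$ equals the right-hand side of 1 at $(w_t,X_t)$, and $V_{t+1}$ equals the left-hand side of 3 at $w=w_t$, $y=X_{t+1}+w_t$; so the portfolio bought at $t$ for $V_t$ is worth exactly $V_{t+1}$ at $t+1$. -/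

import Mathlib

open MeasureTheory ProbabilityTheory Set

noncomputable section

namespace RollUp

/-! ### The asset price and its vanilla options -/

/-- The asset price `S`, observed at the withdrawal dates `0, …, N` (zero interest rates), is a
one-factor Markov process with transition kernels `κ`, prices are nonnegative, and the transition
laws are continuous: they have a density on `(0, ∞)`, an atom at `0` being allowed. -/
structure AssumptionA1 {Ω : Type*} {m : MeasurableSpace Ω} (Q : Measure Ω) (ℱ : Filtration ℕ m)
    (S : ℕ → Ω → ℝ) (κ : ℕ → Kernel ℝ ℝ) (N : ℕ) : Prop where
  nonneg : ∀ t < N, ∀ s, 0 ≤ s → κ t s (Iio 0) = 0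
  markov : ∀ t < N, ∀ B, MeasurableSet B →
    Q[(S (t + 1) ⁻¹' B).indicator (fun _ => (1 : ℝ)) | ℱ t] =ᵐ[Q]
      fun ω => (κ t (S t ω)).real B
  continuous : ∀ t < N, ∀ s, 0 < s → ((κ t s).restrict (Ioi 0)).AbsolutelyContinuous volume

/-- `P_t(K | x)`: value at date `t`, at spot `x`, of the put with strike `K` and maturity `t+1`. -/
def put (κ : ℕ → Kernel ℝ ℝ) (t : ℕ) (K x : ℝ) : ℝ := ∫ y, max (K - y) 0 ∂(κ t x)

/-- `C_t(K | x)`: value at date `t`, at spot `x`, of the call with strike `K` and maturity `t+1`. -/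
def call (κ : ℕ → Kernel ℝ ℝ) (t : ℕ) (K x : ℝ) : ℝ := ∫ y, max (y - K) 0 ∂(κ t x)

/-- Delta of the put: its first derivative in the spot. -/
def putDelta (κ : ℕ → Kernel ℝ ℝ) (t : ℕ) (K x : ℝ) : ℝ := deriv (fun z => put κ t K z) x

/-- Delta of the call. -/
def callDelta (κ : ℕ → Kernel ℝ ℝ) (t : ℕ) (K x : ℝ) : ℝ := deriv (fun z => call κ t K z) x

/-- Gamma of the put: its second derivative in the spot. -/
def gamma (κ : ℕ → Kernel ℝ ℝ) (t : ℕ) (K x : ℝ) : ℝ := deriv (fun z => putDelta κ t K z) x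

/-- The scaling property of the put values. -/
def AssumptionA2 (κ : ℕ → Kernel ℝ ℝ) (N : ℕ) : Prop :=
  ∀ t < N, ∀ a, 0 < a → ∀ K, 0 < K → ∀ s, 0 < s → put κ t (a * K) (a * s) = a * put κ t K s

/-! ### The fund, the guarantee claims and their value -/

/-- The pair `(X_t, w_t)` of fund value (after withdrawal) and guaranteed withdrawal level, with
`X_{t+1} = X_t S_{t+1} / S_t - w_t` and roll-up `w_{t+1} = max (w_t, X_{t+1} / A_{t+1})`, except
that there is no roll-up at maturity `N`. -/
def fundPair {Ω : Type*} (S : ℕ → Ω → ℝ) (A : ℕ → ℝ) (N : ℕ) (x₀ w₀ : ℝ) : ℕ → Ω → ℝ × ℝ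
  | 0, _ => (x₀, w₀)
  | t + 1, ω =>
    let p := fundPair S A N x₀ w₀ t ω
    let x := p.1 * (S (t + 1) ω / S t ω) - p.2
    (x, if t + 1 < N then max p.2 (x / A (t + 1)) else p.2)

/-- The fund value `X_t`. -/
def fund {Ω : Type*} (S : ℕ → Ω → ℝ) (A : ℕ → ℝ) (N : ℕ) (x₀ w₀ : ℝ) (t : ℕ) (ω : Ω) : ℝ :=
  (fundPair S A N x₀ w₀ t ω).1

/-- The guaranteed withdrawal level `w_t`. -/
def level {Ω : Type*} (S : ℕ → Ω → ℝ) (A : ℕ → ℝ) (N : ℕ) (x₀ w₀ : ℝ) (t : ℕ) (ω : Ω) : ℝ :=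
  (fundPair S A N x₀ w₀ t ω).2

/-- The depletion time `τ = inf {t ≤ N : X_t ≤ 0}`, with value `⊤` if there is no depletion. -/
def depletionTime {Ω : Type*} (S : ℕ → Ω → ℝ) (A : ℕ → ℝ) (N : ℕ) (x₀ w₀ : ℝ) (ω : Ω) : ℕ∞ :=
  sInf ((fun u : ℕ => (u : ℕ∞)) '' {u : ℕ | u ≤ N ∧ fund S A N x₀ w₀ u ω ≤ 0})

open Classical in
/-- The claim `Z^{(t)}` that the guarantor pays at date `t`:
`Z^{(0)} = 0` and `Z^{(t)} = w_{t-1} 1_{τ ≤ t-1} + X_t⁻ 1_{τ = t}` for `t ≥ 1`. -/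
def claim {Ω : Type*} (S : ℕ → Ω → ℝ) (A : ℕ → ℝ) (N : ℕ) (x₀ w₀ : ℝ) : ℕ → Ω → ℝ
  | 0, _ => 0
  | t + 1, ω =>
    (if depletionTime S A N x₀ w₀ ω ≤ (t : ℕ∞) then level S A N x₀ w₀ t ω else 0) +
    (if depletionTime S A N x₀ w₀ ω = ((t + 1 : ℕ) : ℕ∞)
      then -min 0 (fund S A N x₀ w₀ (t + 1) ω) else 0)

/-- The market value process `V_t = E_t[∑_{u = t}^N Z^{(u)}]` of the guarantee with roll-up. -/
def valueProcess {Ω : Type*} {m : MeasurableSpace Ω} (Q : Measure Ω) (ℱ : Filtration ℕ m)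
    (S : ℕ → Ω → ℝ) (A : ℕ → ℝ) (N : ℕ) (x₀ w₀ : ℝ) (t : ℕ) : Ω → ℝ :=
  Q[fun ω => ∑ u ∈ Finset.Icc t N, claim S A N x₀ w₀ u ω | ℱ t]

/-- The value function `V^R_t(w, x)` of the guarantee at date `t`, for previous withdrawal level
`w = w_{t-1}` and fund value `x = X_t` when the fund was not depleted before `t`. If `x ≤ 0` (the
fund depletes at `t`) it is `(N - t) w - x`; if `x > 0` it is, for `t < N`, the expected value one
period later with the rolled-up level, and `0` at maturity. A priori it may depend on the asset
price `s = S_t` as well. -/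
def valueFun (κ : ℕ → Kernel ℝ ℝ) (A : ℕ → ℝ) (N : ℕ) (t : ℕ) (w x s : ℝ) : ℝ :=
  if x ≤ 0 then ((N : ℝ) - t) * w - x
  else if _h : t < N then
    ∫ y, valueFun κ A N (t + 1) (max w (x / A t)) (x * (y / s) - max w (x / A t)) y ∂(κ t s)
  else 0
termination_by N - t

/-- `V̄^R_t(w, x) = E[V^R_{t+1}(w, X_{t+1}) | X_t = x, S_t = s]` for the current withdrawal level
`w = w_t`, where `X_{t+1} = x S_{t+1} / s - w`. -/
def valueBar (κ : ℕ → Kernel ℝ ℝ) (A : ℕ → ℝ) (N : ℕ) (t : ℕ) (w x s : ℝ) : ℝ :=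
  ∫ y, valueFun κ A N (t + 1) w (x * (y / s) - w) y ∂(κ t s)

/-! ### The hedge portfolio -/

/-- The coefficients of the hedge: the constants `α`, `β`, and the weight
`dirac • δ₁ + g(k) dk` on the put strikes. -/
structure Weights where
  α : ℝ
  β : ℝ
  dirac : ℝ
  g : ℝ → ℝ

/-- The integral over `[1, b]` of `f` against the weight `dirac • δ₁ + g(k) dk`. -/
def Weights.integrate (W : Weights) (b : ℝ) (f : ℝ → ℝ) : ℝ :=
  W.dirac * f 1 + ∫ k in Icc 1 b, f k * W.g k

/-- The backward recursion for the coefficients. At date `N - 1` they are `α = β = 0` and the Dirac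
weight `δ₁`; as `α = β = 0` and `g = 0` there, the value `A N` (formally `∞`) plays no role. -/
def weights (κ : ℕ → Kernel ℝ ℝ) (A : ℕ → ℝ) (N : ℕ) (t : ℕ) : Weights :=
  if _h : t + 1 < N then
    let W := weights κ A N (t + 1)
    let a := A (t + 1)
    let b := 1 + A (t + 2)
    { α := W.α * (1 + 1 / A (t + 2) * call κ (t + 1) b a) + W.β * put κ (t + 1) b a
        + W.integrate b (fun k => put κ (t + 1) k a)
      β := -(W.α / A (t + 2) * callDelta κ (t + 1) b a + W.β * putDelta κ (t + 1) b a
        + W.integrate b (fun k => putDelta κ (t + 1) k a))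
      dirac := 0
      g := fun k => (W.α / A (t + 2) + W.β) * gamma κ (t + 1) b (k - 1)
        + W.integrate b (fun k' => gamma κ (t + 1) k' (k - 1)) }
  else { α := 0, β := 0, dirac := 1, g := fun _ => 0 }
termination_by N - t

/-- Value at date `t` of the portfolio set up at `t`, at withdrawal level `w` and fund value `x`:
`α_t [w + C_t(w(1+A_{t+1})|x) / A_{t+1}] + β_t P_t(w(1+A_{t+1})|x)
  + ∫_{[1, 1+A_{t+1}]} P_t(wk|x) g_t(k) dk`. -/
def hedgeValue (κ : ℕ → Kernel ℝ ℝ) (A : ℕ → ℝ) (N : ℕ) (t : ℕ) (w x : ℝ) : ℝ :=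
  let W := weights κ A N t
  let b := 1 + A (t + 1)
  W.α * (w + 1 / A (t + 1) * call κ t (w * b) x) + W.β * put κ t (w * b) x
    + W.integrate b (fun k => put κ t (w * k) x)

/-- Payoff at date `t + 1` of the same portfolio, if the fund is worth `y` before the withdrawal
at `t + 1`: every put and call is replaced by its payoff. -/
def hedgePayoff (κ : ℕ → Kernel ℝ ℝ) (A : ℕ → ℝ) (N : ℕ) (t : ℕ) (w y : ℝ) : ℝ :=
  let W := weights κ A N t
  let b := 1 + A (t + 1)
  W.α * (w + 1 / A (t + 1) * max (y - w * b) 0) + W.β * max (w * b - y) 0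
    + W.integrate b (fun k => max (w * k - y) 0)

end RollUp

end

/-!
The put values determine a law on `[0, ∞)`, since their difference quotients in the strike converge
to its distribution function. The scaling assumption therefore says that the next price is
`s R_t`, where the law of `R_t` does not depend on the spot `s`, and the martingale property gives
`E R_t = 1`. All values become homogeneous in `(w, x)`, so one may take `w = 1`. The put delta is
`-M(K / x)`, where `M(u) = E[R_t; R_t ≤ u]` is absolutely continuous because `R_t` has a density.

Replication goes backwards in time. After put–call parity, the portfolio of date `t + 1` is worth,
at a spot `x` below the roll-up point `a = A_{t+1}`, a mixture of put values and an affine function.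
Its Taylor expansion at `a` with integral remainder,
`f(x) = f(a) - f'(a) (a - x) + ∫_x^a (k - x) f''(k) dk`, exhibits it as a combination of cash and
put payoffs with strikes in `[1, 1 + a]`; value, slope and second derivative give `α_t`, `-β_t` and
`g_t`. Above `a`, the roll-up and homogeneity make the value linear, which is the call payoff. The
statement on the value process follows by the tower property and the Markov property.
-/

namespace RollUp

/-! ### Calculus and measure theory -/

section Calculus

variable {E : Type*} [NormedAddCommGroup E] [NormedSpace ℝ E]

theorem ae_hasDerivAt_integral_Iic [CompleteSpace E] {f : ℝ → E} (hf : Integrable f) :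
    ∀ᵐ u, HasDerivAt (fun v => ∫ r in Iic v, f r) (f u) u := by
  have hsplit : (fun v => ∫ r in Iic v, f r) =
      fun v => (∫ r in Iic 0, f r) + ∫ r in (0 : ℝ)..v, f r := by
    ext v
    rw [← intervalIntegral.integral_Iic_sub_Iic hf.integrableOn hf.integrableOn, add_sub_cancel]
  filter_upwards [LocallyIntegrable.ae_hasDerivAt_integral hf.locallyIntegrable] with u hu
  rw [hsplit]
  exact (hu 0).const_add _

theorem hasDerivAt_const_div (K : ℝ) {x : ℝ} (hx : x ≠ 0) :
    HasDerivAt (fun z => K / z) (-(K / x ^ 2)) x := by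
  simpa [div_eq_mul_inv] using (hasDerivAt_inv hx).const_mul K

theorem deriv_comp_const_div (f : ℝ → E) {K x : ℝ} (hK : K ≠ 0) (hx : x ≠ 0) :
    deriv (fun z => f (K / z)) x = -(K / x ^ 2) • deriv f (K / x) := by
  by_cases hf : DifferentiableAt ℝ f (K / x)
  · exact (hf.hasDerivAt.scomp x (hasDerivAt_const_div K hx)).deriv
  · rw [deriv_zero_of_not_differentiableAt hf, smul_zero]
    refine deriv_zero_of_not_differentiableAt fun hcomp => hf ?_
    have hinv : DifferentiableAt ℝ (fun z => K / z) (K / x) :=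
      (hasDerivAt_const_div K (div_ne_zero hK hx)).differentiableAt
    rw [← div_div_cancel₀ (b := x) hK] at hcomp
    simpa [Function.comp_def, div_div_cancel₀ hK] using hcomp.comp (K / x) hinv

theorem image_const_div_Ioi_zero {K : ℝ} (hK : 0 < K) : (fun z => K / z) '' Ioi 0 = Ioi 0 := by
  ext u
  exact ⟨fun ⟨z, hz, hu⟩ => hu ▸ div_pos hK hz,
    fun hu => ⟨K / u, div_pos hK hu, div_div_cancel₀ hK.ne'⟩⟩

theorem injective_const_div {K : ℝ} (hK : K ≠ 0) : Function.Injective fun z : ℝ => K / z :=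
  Function.LeftInverse.injective (g := fun z => K / z) fun _ => div_div_cancel₀ hK

theorem abs_neg_div_sq_smul {K : ℝ} (hK : 0 < K) (z : ℝ) (v : E) :
    |-(K / z ^ 2)| • v = (K / z ^ 2) • v := by
  rw [abs_neg, abs_of_nonneg (by positivity)]

theorem integrableOn_Ioi_comp_const_div_iff {K : ℝ} (hK : 0 < K) (f : ℝ → E) :
    IntegrableOn (fun z => (K / z ^ 2) • f (K / z)) (Ioi 0) ↔ IntegrableOn f (Ioi 0) := by
  conv_rhs => rw [← image_const_div_Ioi_zero hK]
  rw [integrableOn_image_iff_integrableOn_abs_deriv_smul measurableSet_Ioi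
    (fun z hz => (hasDerivAt_const_div K (ne_of_gt hz)).hasDerivWithinAt)
    (injective_const_div hK.ne').injOn]
  simp only [abs_neg_div_sq_smul hK]

theorem integral_comp_const_div_Ioi {K : ℝ} (hK : 0 < K) (f : ℝ → E) :
    ∫ z in Ioi 0, (K / z ^ 2) • f (K / z) = ∫ u in Ioi 0, f u := by
  conv_rhs => rw [← image_const_div_Ioi_zero hK]
  rw [integral_image_eq_integral_abs_deriv_smul measurableSet_Ioi
    (fun z hz => (hasDerivAt_const_div K (ne_of_gt hz)).hasDerivWithinAt)
    (injective_const_div hK.ne').injOn]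
  simp only [abs_neg_div_sq_smul hK]

theorem hasDerivAt_max_zero {u : ℝ} (hu : u ≠ 0) :
    HasDerivAt (fun v : ℝ => max v 0) (if 0 < u then 1 else 0) u := by
  rcases lt_or_gt_of_ne hu with hneg | hpos
  · rw [if_neg hneg.not_gt]
    refine (hasDerivAt_const u 0).congr_of_eventuallyEq ?_
    filter_upwards [gt_mem_nhds hneg] with v hv using max_eq_right hv.le
  · rw [if_pos hpos]
    refine (hasDerivAt_id u).congr_of_eventuallyEq ?_
    filter_upwards [lt_mem_nhds hpos] with v hv using max_eq_left hv.le

end Calculus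

theorem max_sub_zero_eq_sub_add (x K : ℝ) : max (x - K) 0 = x - K + max (K - x) 0 := by
  have hparity := max_zero_sub_eq_self (x - K)
  rw [neg_sub] at hparity
  linarith

theorem tendsto_mul_put_spread (a y : ℝ) :
    Filter.Tendsto (fun n : ℕ => ((n : ℝ) + 1) * (max (a + 1 / (n + 1) - y) 0 - max (a - y) 0))
      Filter.atTop (nhds ((Iic a).indicator 1 y)) := by
  by_cases hy : y ≤ a
  · rw [indicator_of_mem (mem_Iic.2 hy), Pi.one_apply]
    refine tendsto_const_nhds.congr fun n => ?_
    have hn : (0 : ℝ) < 1 / (n + 1) := by positivity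
    rw [max_eq_left (by linarith), max_eq_left (by linarith)]
    field_simp
    ring
  · rw [indicator_of_notMem (notMem_Iic.2 (not_le.1 hy))]
    refine tendsto_const_nhds.congr' ?_
    filter_upwards [tendsto_one_div_add_atTop_nhds_zero_nat.eventually
      (gt_mem_nhds (sub_pos.2 (not_le.1 hy)))] with n hn
    rw [max_eq_right (by linarith), max_eq_right (by linarith), sub_zero, mul_zero]

theorem abs_mul_put_spread_le_one (a y : ℝ) (n : ℕ) :
    |((n : ℝ) + 1) * (max (a + 1 / (n + 1) - y) 0 - max (a - y) 0)| ≤ 1 := by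
  have hn : (0 : ℝ) < n + 1 := by positivity
  rw [abs_mul, abs_of_pos hn, ← le_div_iff₀' hn]
  refine (abs_max_sub_max_le_abs _ _ _).trans_eq ?_
  rw [sub_sub_sub_cancel_right, add_sub_cancel_left, abs_of_pos (by positivity)]

theorem tendsto_integral_put_spread {μ : Measure ℝ} [IsFiniteMeasure μ]
    (hμ : ∀ K, Integrable (fun y => max (K - y) 0) μ) (a : ℝ) :
    Filter.Tendsto (fun n : ℕ => ((n : ℝ) + 1) *
      ((∫ y, max (a + 1 / (n + 1) - y) 0 ∂μ) - ∫ y, max (a - y) 0 ∂μ))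
      Filter.atTop (nhds (μ.real (Iic a))) := by
  simp_rw [← integral_sub (hμ _) (hμ _), ← integral_const_mul]
  rw [← integral_indicator_one measurableSet_Iic]
  exact tendsto_integral_of_dominated_convergence (fun _ => 1)
    (fun n => Measurable.aestronglyMeasurable (by fun_prop)) (integrable_const _)
    (fun n => .of_forall fun y => abs_mul_put_spread_le_one a y n)
    (.of_forall fun y => tendsto_mul_put_spread a y)

theorem measure_eq_of_integral_put_eq {μ ν : Measure ℝ} [IsFiniteMeasure μ] [IsFiniteMeasure ν]
    (hμ : ∀ K, Integrable (fun y => max (K - y) 0) μ)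
    (hν : ∀ K, Integrable (fun y => max (K - y) 0) ν)
    (hput : ∀ K, ∫ y, max (K - y) 0 ∂μ = ∫ y, max (K - y) 0 ∂ν) : μ = ν := by
  refine Measure.ext_of_Iic μ ν fun a => ?_
  have hlim := tendsto_integral_put_spread hμ a
  simp_rw [hput] at hlim
  exact (measureReal_eq_measureReal_iff (measure_ne_top _ _) (measure_ne_top _ _)).1
    (tendsto_nhds_unique hlim (tendsto_integral_put_spread hν a))

theorem integrable_put_payoff_of_nonneg {μ : Measure ℝ} [IsFiniteMeasure μ]
    (hμ : ∀ᵐ y ∂μ, 0 ≤ y) (K : ℝ) : Integrable (fun y => max (K - y) 0) μ := by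
  refine Integrable.of_bound (Measurable.aestronglyMeasurable (by fun_prop)) |K| ?_
  filter_upwards [hμ] with y hy
  rw [Real.norm_of_nonneg (le_max_right _ _)]
  exact max_le (by linarith [le_abs_self K]) (abs_nonneg K)

theorem integral_put_payoff_eq_zero {μ : Measure ℝ} (hμ : ∀ᵐ y ∂μ, 0 ≤ y) {K : ℝ} (hK : K ≤ 0) :
    ∫ y, max (K - y) 0 ∂μ = 0 := by
  refine integral_eq_zero_of_ae ?_
  filter_upwards [hμ] with y hy
  exact max_eq_right (by linarith)

theorem eq_map_mul_of_integral_put_eq {μ ν : Measure ℝ} [IsFiniteMeasure μ] [IsFiniteMeasure ν]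
    (hμ : ∀ᵐ y ∂μ, 0 ≤ y) (hν : ∀ᵐ r ∂ν, 0 ≤ r) {s : ℝ} (hs : 0 < s)
    (hput : ∀ K, 0 < K → ∫ y, max (s * K - y) 0 ∂μ = s * ∫ r, max (K - r) 0 ∂ν) :
    μ = ν.map (s * ·) := by
  have hmap : ∀ᵐ y ∂ν.map (s * ·), 0 ≤ y := by
    rw [ae_map_iff (by fun_prop) measurableSet_Ici]
    filter_upwards [hν] with r hr using mul_nonneg hs.le hr
  refine measure_eq_of_integral_put_eq (integrable_put_payoff_of_nonneg hμ)
    (integrable_put_payoff_of_nonneg hmap) fun K => ?_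
  rcases le_or_gt K 0 with hK | hK
  · rw [integral_put_payoff_eq_zero hμ hK, integral_put_payoff_eq_zero hmap hK]
  · have hscaled := hput (K / s) (div_pos hK hs)
    rw [mul_div_cancel₀ _ hs.ne'] at hscaled
    rw [hscaled, (measurableEmbedding_mulLeft₀ hs.ne').integral_map, ← integral_const_mul]
    congr with r
    rw [mul_max_of_nonneg _ _ hs.le, mul_zero, mul_sub, mul_div_cancel₀ _ hs.ne']

section CondExp

variable {Ω β γ E : Type*} {m : MeasurableSpace Ω} {mβ : MeasurableSpace β}
  {mγ : MeasurableSpace γ} {Q : Measure Ω}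

theorem condExp_eq_on_of_ae_eq [NormedAddCommGroup E] [NormedSpace ℝ E] [CompleteSpace E]
    {𝓖 : MeasurableSpace Ω} {s : Set Ω} (hs : MeasurableSet[𝓖] s) {f g : Ω → E}
    (hf : Integrable f Q) (hg : Integrable g Q) (hfg : ∀ᵐ ω ∂Q, ω ∈ s → f ω = g ω) :
    ∀ᵐ ω ∂Q, ω ∈ s → (Q[f | 𝓖]) ω = (Q[g | 𝓖]) ω := by
  have hind : s.indicator f =ᵐ[Q] s.indicator g := by
    filter_upwards [hfg] with ω hω
    by_cases hs : ω ∈ s <;> simp [hs, hω]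
  filter_upwards [condExp_congr_ae (m := 𝓖) hind, condExp_indicator hf hs,
    condExp_indicator hg hs] with ω hω hfω hgω hmem
  rwa [hfω, hgω, indicator_of_mem hmem, indicator_of_mem hmem] at hω

variable [IsFiniteMeasure Q] {X : Ω → β} {Y : Ω → γ} {η : Kernel β γ}

theorem setLIntegral_kernel_eq_of_condExp_indicator [IsMarkovKernel η] (hX : Measurable X)
    {B : Set γ} (hYB : MeasurableSet (Y ⁻¹' B)) (hB : MeasurableSet B)
    (hη : Q[(Y ⁻¹' B).indicator (fun _ => (1 : ℝ)) | mβ.comap X] =ᵐ[Q] fun ω => (η (X ω)).real B)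
    {s : Set β} (hs : MeasurableSet s) :
    ∫⁻ ω in X ⁻¹' s, η (X ω) B ∂Q = Q (X ⁻¹' s ∩ Y ⁻¹' B) := by
  have hcond := setIntegral_condExp hX.comap_le (s := X ⁻¹' s)
    ((integrable_const (1 : ℝ)).indicator hYB : Integrable _ Q) ⟨s, hs, rfl⟩
  have hmass : ∫ ω in X ⁻¹' s, (η (X ω)).real B ∂Q =
      (∫⁻ ω in X ⁻¹' s, η (X ω) B ∂Q).toReal :=
    integral_toReal ((η.measurable_coe hB).comp hX).aemeasurable
      (.of_forall fun _ => measure_lt_top _ _)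
  rw [setIntegral_congr_ae (hX hs) (hη.mono fun ω hω _ => hω), hmass, setIntegral_indicator hYB,
    setIntegral_const, smul_eq_mul, mul_one] at hcond
  refine (ENNReal.toReal_eq_toReal_iff' (ne_of_lt ?_) (measure_ne_top _ _)).1 hcond
  calc ∫⁻ ω in X ⁻¹' s, η (X ω) B ∂Q ≤ ∫⁻ _ in X ⁻¹' s, 1 ∂Q := lintegral_mono fun _ => prob_le_one
    _ < ⊤ := by simp

theorem map_prodMk_eq_compProd_of_condExp_indicator [IsMarkovKernel η] (hX : Measurable X)
    (hY : Measurable Y)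
    (hη : ∀ B, MeasurableSet B → Q[(Y ⁻¹' B).indicator (fun _ => (1 : ℝ)) | mβ.comap X] =ᵐ[Q]
      fun ω => (η (X ω)).real B) :
    Q.map (fun ω => (X ω, Y ω)) = Q.map X ⊗ₘ η := by
  have := Measure.isFiniteMeasure_map Q X
  have := Measure.isFiniteMeasure_map Q fun ω => (X ω, Y ω)
  refine Measure.ext_prod fun {s B} hs hB => ?_
  rw [Measure.map_apply (hX.prodMk hY) (hs.prod hB), Measure.compProd_apply_prod hs hB,
    setLIntegral_map hs (η.measurable_coe hB) hX,
    setLIntegral_kernel_eq_of_condExp_indicator hX (hY hB) hB (hη B hB) hs]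
  rfl

variable [NormedAddCommGroup E] {F : β × γ → E}

theorem condExp_comp_prodMk_ae_eq_integral_kernel [StandardBorelSpace γ] [Nonempty γ]
    [NormedSpace ℝ E] [CompleteSpace E] [IsFiniteKernel η] (hX : Measurable X)
    (hY : Measurable Y) (hη : Q.map (fun ω => (X ω, Y ω)) = Q.map X ⊗ₘ η)
    (hF : StronglyMeasurable F) (hi : Integrable (fun ω => F (X ω, Y ω)) Q) :
    Q[fun ω => F (X ω, Y ω) | mβ.comap X] =ᵐ[Q] fun ω => ∫ y, F (X ω, y) ∂(η (X ω)) := by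
  filter_upwards [condExp_prod_ae_eq_integral_condDistrib hX hY.aemeasurable hF hi,
    ae_of_ae_map hX.aemeasurable (condDistrib_ae_eq_of_measure_eq_compProd_of_measurable hX hY hη)]
    with ω hcond hlaw
  rw [hcond, hlaw]

theorem integrable_comp_prodMk_iff_kernel [IsSFiniteKernel η] (hX : Measurable X)
    (hY : Measurable Y) (hη : Q.map (fun ω => (X ω, Y ω)) = Q.map X ⊗ₘ η)
    (hF : StronglyMeasurable F) :
    Integrable (fun ω => F (X ω, Y ω)) Q ↔
      (∀ᵐ ω ∂Q, Integrable (fun y => F (X ω, y)) (η (X ω))) ∧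
      Integrable (fun ω => ∫ y, ‖F (X ω, y)‖ ∂(η (X ω))) Q := by
  have hjoint : Integrable (fun ω => F (X ω, Y ω)) Q ↔ Integrable F (Q.map X ⊗ₘ η) := by
    rw [← hη, integrable_map_measure hF.aestronglyMeasurable (hX.prodMk hY).aemeasurable]
    rfl
  have hnorm : StronglyMeasurable fun x => ∫ y, ‖F (x, y)‖ ∂(η x) :=
    hF.norm.integral_kernel_prod_right'
  rw [hjoint, Measure.integrable_compProd_iff hF.aestronglyMeasurable,
    integrable_map_measure hnorm.aestronglyMeasurable hX.aemeasurable,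
    ae_map_iff hX.aemeasurable
      (measurableSet_kernel_integrable (f := fun x y => F (x, y)) hF)]
  rfl

end CondExp

theorem backward_induction {P : ℕ → Prop} {N : ℕ}
    (step : ∀ t < N, (t + 1 < N → P (t + 1)) → P t) : ∀ t < N, P t := by
  intro t
  induction hn : N - t generalizing t with
  | zero => omega
  | succ n ih => exact fun ht => step t ht fun ht' => ih (t + 1) (by omega) ht'

/-! ### Puts on a one-period return -/

/-- `ρ` is the law of a nonnegative one-period return with mean one, with a density on `(0, ∞)`
and possibly an atom at `0`. -/
structure IsReturnLaw (ρ : Measure ℝ) : Prop extends IsProbabilityMeasure ρ where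
  nonneg : ∀ᵐ r ∂ρ, 0 ≤ r
  integrable : Integrable (fun r => r) ρ
  mean : ∫ r, r ∂ρ = 1
  ac : (ρ.restrict (Ioi 0)).AbsolutelyContinuous volume

/-- The value of a put with strike `K` on `x` times the return. -/
noncomputable def returnPut (ρ : Measure ℝ) (K x : ℝ) : ℝ := ∫ r, max (K - x * r) 0 ∂ρ

/-- The partial mean `E[R; R ≤ u]` of the return, minus which, at `u = K / x`, is the delta of the
put. -/
noncomputable def partialMean (ρ : Measure ℝ) (u : ℝ) : ℝ := ∫ r in Iic u, r ∂ρ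

/-- The gamma of the put: the second derivative in `x` of `returnPut ρ K x`. -/
noncomputable def returnGamma (ρ : Measure ℝ) (K x : ℝ) : ℝ :=
  K / x ^ 2 * deriv (partialMean ρ) (K / x)

theorem put_payoff_sub_put_payoff_eq {K a x r : ℝ} (ha : 0 < a) (hx : x ≤ a) (hr : 0 ≤ r) :
    (Iio a).indicator (fun z => max (z - x) 0) (K / r) * r =
      max (K - x * r) 0 - max (K - a * r) 0 - (a - x) * (Iic (K / a)).indicator (fun r => r) r := by
  rcases hr.eq_or_lt with rfl | hr
  · simp [indicator]
  have hslope : x * r ≤ a * r := mul_le_mul_of_nonneg_right hx hr.le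
  by_cases hra : a * r ≤ K
  · have hnotMem : K / r ∉ Iio a := notMem_Iio.2 ((le_div_iff₀ hr).2 hra)
    have hmem : r ∈ Iic (K / a) := (le_div_iff₀' ha).2 hra
    rw [indicator_of_notMem hnotMem, indicator_of_mem hmem, max_eq_left (by linarith),
      max_eq_left (by linarith)]
    ring
  · rw [not_le] at hra
    have hmem : K / r ∈ Iio a := (div_lt_iff₀ hr).2 hra
    have hnotMem : r ∉ Iic (K / a) := notMem_Iic.2 ((div_lt_iff₀' ha).2 hra)
    rw [indicator_of_mem hmem, indicator_of_notMem hnotMem, max_eq_right (b := 0) (a := K - a * r)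
      (by linarith), max_mul_of_nonneg _ _ hr.le, sub_mul, div_mul_cancel₀ _ hr.ne', zero_mul]
    ring

theorem hasDerivAt_put_payoff {K x r : ℝ} (hx : 0 < x) (hr : r ≠ K / x) :
    HasDerivAt (fun z => max (K - z * r) 0) (-(Iic (K / x)).indicator (fun r => r) r) x := by
  have hlin : HasDerivAt (fun z => K - z * r) (-r) x := by
    simpa using ((hasDerivAt_id x).mul_const r).const_sub K
  have hne : K - x * r ≠ 0 := fun h => hr (by rw [eq_div_iff hx.ne']; linarith)
  refine ((hasDerivAt_max_zero hne).comp x hlin).congr_deriv ?_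
  have hmem : 0 < K - x * r ↔ r ∈ Iic (K / x) := by
    rw [mem_Iic, le_div_iff₀' hx, sub_pos]
    exact ⟨le_of_lt, fun h => h.lt_of_ne fun h => hne (sub_eq_zero.2 h.symm)⟩
  by_cases h : r ∈ Iic (K / x)
  · simp [hmem.2 h, h]
  · simp [mt hmem.1 h, h]

section ReturnPut

variable {ρ : Measure ℝ}

theorem measurable_returnGamma (ρ : Measure ℝ) :
    Measurable (fun p : ℝ × ℝ => returnGamma ρ p.1 p.2) := by
  have := measurable_deriv (partialMean ρ)
  unfold returnGamma
  fun_prop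

theorem deriv_neg_partialMean_const_div (ρ : Measure ℝ) {K x : ℝ} (hK : K ≠ 0) (hx : x ≠ 0) :
    deriv (fun z => -partialMean ρ (K / z)) x = returnGamma ρ K x := by
  rw [deriv.fun_neg, deriv_comp_const_div _ hK hx, smul_eq_mul, neg_mul, neg_neg, returnGamma]

namespace IsReturnLaw

theorem partialMean_mono (h : IsReturnLaw ρ) : Monotone (partialMean ρ) := fun _ _ huv =>
  setIntegral_mono_set h.integrable.integrableOn (ae_restrict_of_ae h.nonneg)
    (Iic_subset_Iic.2 huv).eventuallyLE

theorem partialMean_nonneg (h : IsReturnLaw ρ) (u : ℝ) : 0 ≤ partialMean ρ u :=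
  integral_nonneg_of_ae (ae_restrict_of_ae h.nonneg)

theorem partialMean_le_one (h : IsReturnLaw ρ) (u : ℝ) : partialMean ρ u ≤ 1 :=
  (setIntegral_le_integral h.integrable h.nonneg).trans_eq h.mean

theorem measure_singleton (h : IsReturnLaw ρ) {u : ℝ} (hu : 0 < u) : ρ {u} = 0 := by
  have hvol := h.ac (Real.volume_singleton (a := u))
  rwa [Measure.restrict_apply (measurableSet_singleton u),
    inter_eq_left.2 (singleton_subset_iff.2 (mem_Ioi.2 hu))] at hvol

theorem setIntegral_mul_restrict_Ioi (h : IsReturnLaw ρ) (φ : ℝ → ℝ) {s : Set ℝ}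
    (hs : MeasurableSet s) :
    ∫ r in s, φ r * r ∂(ρ.restrict (Ioi 0)) = ∫ r in s, φ r * r ∂ρ := by
  rw [Measure.restrict_restrict hs]
  refine (setIntegral_eq_of_subset_of_ae_sdiff_eq_zero hs.nullMeasurableSet inter_subset_left
    ?_).symm
  filter_upwards [h.nonneg] with r hr hmem
  have hr0 : r ≤ 0 := not_lt.1 fun hpos => hmem.2 ⟨hmem.1, hpos⟩
  rw [le_antisymm hr0 hr, mul_zero]

theorem deriv_partialMean_ae_eq (h : IsReturnLaw ρ) : deriv (partialMean ρ) =ᵐ[volume]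
    fun r => ((ρ.restrict (Ioi 0)).rnDeriv volume r).toReal * r := by
  have := h.toIsProbabilityMeasure
  have hdensity := (integrable_toReal_rnDeriv_mul_iff h.ac).2 h.integrable.restrict
  filter_upwards [ae_hasDerivAt_integral_Iic hdensity] with u hu
  rw [← hu.deriv]
  congr with v
  rw [setIntegral_toReal_rnDeriv_mul h.ac measurableSet_Iic, partialMean]
  simpa using (h.setIntegral_mul_restrict_Ioi 1 measurableSet_Iic).symm

theorem integrable_mul_deriv_partialMean (h : IsReturnLaw ρ) {φ : ℝ → ℝ}
    (hφ : Integrable (fun r => φ r * r) ρ) :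
    Integrable (fun u => φ u * deriv (partialMean ρ) u) := by
  have := h.toIsProbabilityMeasure
  refine ((integrable_toReal_rnDeriv_mul_iff h.ac).2 hφ.restrict).congr ?_
  filter_upwards [h.deriv_partialMean_ae_eq] with u hu
  rw [hu, mul_left_comm]

theorem setIntegral_Ioi_mul_deriv_partialMean (h : IsReturnLaw ρ) (φ : ℝ → ℝ) :
    ∫ u in Ioi 0, φ u * deriv (partialMean ρ) u = ∫ r, φ r * r ∂ρ := by
  have := h.toIsProbabilityMeasure
  calc ∫ u in Ioi 0, φ u * deriv (partialMean ρ) u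
      = ∫ u in Ioi 0, ((ρ.restrict (Ioi 0)).rnDeriv volume u).toReal * (φ u * u) := by
        refine integral_congr_ae (ae_restrict_of_ae ?_)
        filter_upwards [h.deriv_partialMean_ae_eq] with u hu
        rw [hu, mul_left_comm]
    _ = ∫ r in univ, φ r * r ∂(ρ.restrict (Ioi 0)) := by
        rw [setIntegral_toReal_rnDeriv_mul h.ac measurableSet_Ioi,
          Measure.restrict_restrict measurableSet_Ioi, inter_self, Measure.restrict_univ]
    _ = ∫ r, φ r * r ∂ρ := by
        rw [h.setIntegral_mul_restrict_Ioi φ .univ, Measure.restrict_univ]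

theorem integrableOn_mul_returnGamma (h : IsReturnLaw ρ) {K : ℝ} (hK : 0 < K) {ψ : ℝ → ℝ}
    (hψ : Integrable (fun r => ψ (K / r) * r) ρ) :
    IntegrableOn (fun z => ψ z * returnGamma ρ K z) (Ioi 0) := by
  have hcomp := (integrableOn_Ioi_comp_const_div_iff hK _).2
    (h.integrable_mul_deriv_partialMean hψ).integrableOn
  simpa only [div_div_cancel₀ hK.ne', smul_eq_mul, mul_left_comm] using! hcomp

theorem integral_mul_returnGamma (h : IsReturnLaw ρ) {K : ℝ} (hK : 0 < K) (ψ : ℝ → ℝ) :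
    ∫ z in Ioi 0, ψ z * returnGamma ρ K z = ∫ r, ψ (K / r) * r ∂ρ := by
  rw [← h.setIntegral_Ioi_mul_deriv_partialMean fun r => ψ (K / r),
    ← integral_comp_const_div_Ioi hK fun u => ψ (K / u) * deriv (partialMean ρ) u]
  simp only [div_div_cancel₀ hK.ne', smul_eq_mul, returnGamma, mul_left_comm]

theorem returnGamma_nonneg (h : IsReturnLaw ρ) {K : ℝ} (hK : 0 ≤ K) (z : ℝ) :
    0 ≤ returnGamma ρ K z :=
  mul_nonneg (by positivity) h.partialMean_mono.deriv_nonneg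

theorem integrableOn_returnGamma (h : IsReturnLaw ρ) {K : ℝ} (hK : 0 < K) :
    IntegrableOn (returnGamma ρ K) (Ioi 0) := by
  simpa using h.integrableOn_mul_returnGamma hK (ψ := 1) (by simpa using h.integrable)

theorem integral_returnGamma (h : IsReturnLaw ρ) {K : ℝ} (hK : 0 < K) :
    ∫ z in Ioi 0, returnGamma ρ K z = 1 := by
  simpa [h.mean] using h.integral_mul_returnGamma hK 1

theorem integrable_put_payoff (h : IsReturnLaw ρ) (K x : ℝ) :
    Integrable (fun r => max (K - x * r) 0) ρ := by
  have := h.toIsProbabilityMeasure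
  exact ((integrable_const K).sub (h.integrable.const_mul x)).pos_part

theorem integral_const_sub_mul (h : IsReturnLaw ρ) (K x : ℝ) : ∫ r, (K - x * r) ∂ρ = K - x := by
  have := h.toIsProbabilityMeasure
  rw [integral_sub (integrable_const K) (h.integrable.const_mul x), integral_const_mul, h.mean]
  simp

theorem returnPut_of_nonpos (h : IsReturnLaw ρ) {K x : ℝ} (hK : 0 ≤ K) (hx : x ≤ 0) :
    returnPut ρ K x = K - x := by
  rw [← h.integral_const_sub_mul]
  refine integral_congr_ae ?_
  filter_upwards [h.nonneg] with r hr
  exact max_eq_left (by linarith [mul_nonpos_of_nonpos_of_nonneg hx hr])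

theorem lipschitz_returnPut (h : IsReturnLaw ρ) (x : ℝ) :
    LipschitzWith 1 (fun K => returnPut ρ K x) := by
  have := h.toIsProbabilityMeasure
  refine LipschitzWith.of_dist_le_mul fun K L => ?_
  rw [Real.dist_eq, Real.dist_eq, returnPut, returnPut,
    ← integral_sub (h.integrable_put_payoff K x) (h.integrable_put_payoff L x)]
  have hpayoff : ∀ᵐ r ∂ρ, ‖max (K - x * r) 0 - max (L - x * r) 0‖ ≤ |K - L| :=
    .of_forall fun r => (abs_max_sub_max_le_abs _ _ _).trans_eq (by ring_nf)
  exact (norm_integral_le_of_norm_le_const hpayoff).trans (by simp)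

/-- The second-order Taylor expansion of the put at `a`, with integral remainder. -/
theorem integral_pos_part_mul_returnGamma (h : IsReturnLaw ρ) {K a x : ℝ} (hK : 0 < K) (ha : 0 < a)
    (hx : x ≤ a) :
    ∫ z in Ioi 0, (Iio a).indicator (fun z => max (z - x) 0) z * returnGamma ρ K z =
      returnPut ρ K x - returnPut ρ K a - (a - x) * partialMean ρ (K / a) := by
  have hmean : Integrable ((Iic (K / a)).indicator fun r => r) ρ :=
    h.integrable.indicator measurableSet_Iic
  have hspread := (h.integrable_put_payoff K x).sub (h.integrable_put_payoff K a)
  rw [h.integral_mul_returnGamma hK, partialMean, ← integral_indicator measurableSet_Iic,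
    ← integral_const_mul, returnPut, returnPut,
    ← integral_sub (h.integrable_put_payoff K x) (h.integrable_put_payoff K a),
    ← integral_sub (hspread : Integrable (fun r => _ - _) ρ) (hmean.const_mul _)]
  refine integral_congr_ae ?_
  filter_upwards [h.nonneg] with r hr using put_payoff_sub_put_payoff_eq ha hx hr

theorem hasDerivAt_returnPut (h : IsReturnLaw ρ) {K x : ℝ} (hK : 0 < K) (hx : 0 < x) :
    HasDerivAt (returnPut ρ K) (-partialMean ρ (K / x)) x := by
  rw [partialMean, ← integral_indicator measurableSet_Iic, ← integral_neg]
  refine (hasDerivAt_integral_of_dominated_loc_of_lip (𝕜 := ℝ) (bound := fun r => r)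
    Filter.univ_mem (.of_forall fun y => (h.integrable_put_payoff K y).aestronglyMeasurable)
    (h.integrable_put_payoff K x)
    (h.integrable.indicator measurableSet_Iic).neg.aestronglyMeasurable
    (.of_forall fun r => ?_) h.integrable ?_).2
  · refine LipschitzOnWith.of_dist_le_mul fun y _ z _ => ?_
    rw [Real.dist_eq, Real.dist_eq, Real.coe_nnabs, ← abs_mul, abs_sub_comm]
    exact (abs_max_sub_max_le_abs _ _ _).trans_eq (by ring_nf)
  · have hne : ∀ᵐ r ∂ρ, r ≠ K / x := measure_eq_zero_iff_ae_notMem.1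
      (h.measure_singleton (div_pos hK hx))
    filter_upwards [hne] with r hr using hasDerivAt_put_payoff hx hr

theorem ae_differentiableAt_partialMean (h : IsReturnLaw ρ) {K : ℝ} (hK : 0 ≤ K) :
    ∀ᵐ x ∂(volume.restrict (Ioi (0 : ℝ))),
      DifferentiableAt ℝ (fun z => -partialMean ρ (K / z)) x := by
  have hmono : MonotoneOn (fun z => -partialMean ρ (K / z)) (Ioi 0) := fun y hy z _ hyz =>
    neg_le_neg (h.partialMean_mono (div_le_div_of_nonneg_left hK hy hyz))
  filter_upwards [hmono.ae_differentiableWithinAt measurableSet_Ioi,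
    ae_restrict_mem measurableSet_Ioi] with x hx hx0
  exact hx.differentiableAt (Ioi_mem_nhds hx0)

end IsReturnLaw

end ReturnPut

theorem isReturnLaw_of_map_mul {ρ : Measure ℝ} [IsProbabilityMeasure ρ] {s : ℝ} (hs : 0 < s)
    (hnonneg : ∀ᵐ r ∂ρ, 0 ≤ r) (hint : Integrable (fun y => y) (ρ.map (s * ·)))
    (hmean : ∫ y, y ∂(ρ.map (s * ·)) = s)
    (hac : (ρ.restrict (Ioi 0)).AbsolutelyContinuous volume) : IsReturnLaw ρ where
  nonneg := hnonneg
  integrable := by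
    rw [(measurableEmbedding_mulLeft₀ hs.ne').integrable_map_iff] at hint
    exact (integrable_const_mul_iff (isUnit_iff_ne_zero.2 hs.ne') _).1 hint
  mean := by
    rw [(measurableEmbedding_mulLeft₀ hs.ne').integral_map, integral_const_mul] at hmean
    exact mul_left_cancel₀ hs.ne' (hmean.trans (mul_one s).symm)
  ac := hac

/-! ### Mixtures of puts -/

namespace IsReturnLaw

variable {ρ ν : Measure ℝ} {g : ℝ → ℝ}

theorem integrable_partialMean_mul (h : IsReturnLaw ρ) (hg : Integrable g ν) (w x : ℝ) :
    Integrable (fun k => partialMean ρ (w * k / x) * g k) ν := by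
  have hmeas : Measurable fun k => partialMean ρ (w * k / x) :=
    h.partialMean_mono.measurable.comp (by fun_prop)
  refine hg.bdd_mul (c := 1) hmeas.aestronglyMeasurable (.of_forall fun k => ?_)
  rw [Real.norm_of_nonneg (h.partialMean_nonneg _)]
  exact h.partialMean_le_one _

theorem integrable_returnGamma_mul_prod [SFinite ν] (h : IsReturnLaw ρ) (hν : ∀ᵐ k ∂ν, 0 < k)
    (hg : Integrable g ν) :
    Integrable (fun p : ℝ × ℝ => returnGamma ρ p.1 p.2 * g p.1)
      (ν.prod (volume.restrict (Ioi 0))) := by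
  refine (integrable_prod_iff ?_).2 ⟨?_, ?_⟩
  · exact (measurable_returnGamma ρ).aestronglyMeasurable.mul hg.aestronglyMeasurable.comp_fst
  · filter_upwards [hν] with k hk using (h.integrableOn_returnGamma hk).mul_const _
  · refine hg.norm.congr ?_
    filter_upwards [hν] with k hk
    simp only [norm_mul, integral_mul_const, Real.norm_of_nonneg (h.returnGamma_nonneg hk.le _)]
    rw [h.integral_returnGamma hk, one_mul]

theorem integrable_mul_returnGamma_mul_prod [SFinite ν] (h : IsReturnLaw ρ) (hν : ∀ᵐ k ∂ν, 0 < k)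
    (hg : Integrable g ν) {ψ : ℝ → ℝ} (hψ : Measurable ψ) {C : ℝ}
    (hC : ∀ᵐ z ∂(volume.restrict (Ioi (0 : ℝ))), ‖ψ z‖ ≤ C) :
    Integrable (fun p : ℝ × ℝ => ψ p.2 * (returnGamma ρ p.1 p.2 * g p.1))
      (ν.prod (volume.restrict (Ioi 0))) :=
  (h.integrable_returnGamma_mul_prod hν hg).bdd_mul (hψ.comp measurable_snd).aestronglyMeasurable
    (Measure.quasiMeasurePreserving_snd.ae hC)

theorem integral_mul_integral_returnGamma [SFinite ν] (h : IsReturnLaw ρ) (hν : ∀ᵐ k ∂ν, 0 < k)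
    (hg : Integrable g ν) {ψ : ℝ → ℝ} (hψ : Measurable ψ) {C : ℝ}
    (hC : ∀ᵐ z ∂(volume.restrict (Ioi (0 : ℝ))), ‖ψ z‖ ≤ C) :
    ∫ z in Ioi 0, ψ z * ∫ k, returnGamma ρ k z * g k ∂ν =
      ∫ k, (∫ z in Ioi 0, ψ z * returnGamma ρ k z) * g k ∂ν := by
  simp only [← integral_const_mul, ← integral_mul_const, mul_assoc]
  exact (integral_integral_swap (h.integrable_mul_returnGamma_mul_prod hν hg hψ hC)).symm

theorem integrable_put_payoff_mul_prod [SFinite ν] (h : IsReturnLaw ρ) (hg : Integrable g ν)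
    (hkg : Integrable (fun k => k * g k) ν) (w x : ℝ) :
    Integrable (fun p : ℝ × ℝ => max (w * p.1 - x * p.2) 0 * g p.1) (ν.prod ρ) := by
  have := h.toIsProbabilityMeasure
  have hforward : Integrable (fun p : ℝ × ℝ => w * (p.1 * g p.1) - x * (g p.1 * p.2))
      (ν.prod ρ) :=
    ((hkg.comp_fst ρ).const_mul w).sub ((hg.mul_prod h.integrable).const_mul x)
  refine hforward.mono ((Measurable.aestronglyMeasurable (by fun_prop)).mul
    hg.aestronglyMeasurable.comp_fst) (.of_forall fun p => ?_)
  calc ‖max (w * p.1 - x * p.2) 0 * g p.1‖ ≤ ‖w * p.1 - x * p.2‖ * ‖g p.1‖ := by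
        rw [norm_mul, Real.norm_of_nonneg (le_max_right _ _)]
        gcongr
        exact max_le (Real.le_norm_self _) (norm_nonneg _)
    _ = ‖w * (p.1 * g p.1) - x * (g p.1 * p.2)‖ := by
        rw [← norm_mul]
        ring_nf

theorem integral_integral_put_payoff [SFinite ν] (h : IsReturnLaw ρ) (hg : Integrable g ν)
    (hkg : Integrable (fun k => k * g k) ν) (w x : ℝ) :
    ∫ r, ∫ k, max (w * k - x * r) 0 * g k ∂ν ∂ρ = ∫ k, returnPut ρ (w * k) x * g k ∂ν := by
  have := h.toIsProbabilityMeasure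
  simp only [returnPut, ← integral_mul_const]
  exact (integral_integral_swap (h.integrable_put_payoff_mul_prod hg hkg w x)).symm

end IsReturnLaw

/-- The integral of `f` against the weights, with an additional point mass `c` at `b`. After
put–call parity the net position in strike `b` is of this form. -/
noncomputable def Weights.netIntegrate (W : Weights) (c b : ℝ) (f : ℝ → ℝ) : ℝ :=
  c * f b + W.integrate b f

namespace Weights

variable {W : Weights} {b c : ℝ} {f f' : ℝ → ℝ}

theorem integrate_congr (hff : ∀ k, 1 ≤ k → f k = f' k) : W.integrate b f = W.integrate b f' := by
  rw [integrate, integrate, hff 1 le_rfl, setIntegral_congr_fun measurableSet_Icc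
    fun k hk => congrArg (· * W.g k) (hff k hk.1)]

theorem netIntegrate_congr (hb : 1 ≤ b ∨ c = 0) (hff : ∀ k, 1 ≤ k → f k = f' k) :
    W.netIntegrate c b f = W.netIntegrate c b f' := by
  rw [netIntegrate, netIntegrate, integrate_congr hff]
  rcases hb with hb | rfl
  · rw [hff b hb]
  · rw [zero_mul, zero_mul]

theorem integrate_const_mul (W : Weights) (b r : ℝ) (f : ℝ → ℝ) :
    W.integrate b (fun k => r * f k) = r * W.integrate b f := by
  simp only [integrate, mul_assoc, integral_const_mul]
  ring

theorem netIntegrate_const_mul (W : Weights) (c b r : ℝ) (f : ℝ → ℝ) :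
    W.netIntegrate c b (fun k => r * f k) = r * W.netIntegrate c b f := by
  rw [netIntegrate, netIntegrate, integrate_const_mul]
  ring

theorem netIntegrate_sub (hf : IntegrableOn (fun k => f k * W.g k) (Icc 1 b))
    (hf' : IntegrableOn (fun k => f' k * W.g k) (Icc 1 b)) :
    W.netIntegrate c b (fun k => f k - f' k) = W.netIntegrate c b f - W.netIntegrate c b f' := by
  simp only [netIntegrate, integrate, sub_mul]
  rw [integral_sub hf hf']
  ring

theorem integrableOn_continuous_mul (hg : IntegrableOn W.g (Icc 1 b)) (hf : Continuous f) :
    IntegrableOn (fun k => f k * W.g k) (Icc 1 b) :=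
  hg.continuousOn_mul hf.continuousOn isCompact_Icc

theorem ae_pos_restrict_Icc_one (b : ℝ) : ∀ᵐ k ∂(volume.restrict (Icc 1 b)), 0 < k :=
  (ae_restrict_mem measurableSet_Icc).mono fun _ hk => one_pos.trans_le hk.1

section Gamma

variable {ρ : Measure ℝ} (h : IsReturnLaw ρ) (hg : IntegrableOn W.g (Icc 1 b)) (hb : 1 ≤ b ∨ c = 0)

include h hb in
theorem integrableOn_const_mul_returnGamma_endpoint :
    IntegrableOn (fun z => c * returnGamma ρ b z) (Ioi 0) := by
  rcases hb with hb | rfl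
  · exact (h.integrableOn_returnGamma (one_pos.trans_le hb)).const_mul _
  · simp

include h hg hb

theorem integrableOn_netIntegrate_returnGamma :
    IntegrableOn (fun z => W.netIntegrate c b (fun k => returnGamma ρ k z)) (Ioi 0) :=
  (integrableOn_const_mul_returnGamma_endpoint h hb).add
    (((h.integrableOn_returnGamma one_pos).const_mul _).add
      (h.integrable_returnGamma_mul_prod (ae_pos_restrict_Icc_one b) hg).integral_prod_right)

theorem integral_mul_netIntegrate_returnGamma {ψ : ℝ → ℝ} (hψ : Measurable ψ) {C : ℝ}
    (hC : ∀ z, 0 < z → ‖ψ z‖ ≤ C) :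
    ∫ z in Ioi 0, ψ z * W.netIntegrate c b (fun k => returnGamma ρ k z) =
      W.netIntegrate c b (fun k => ∫ z in Ioi 0, ψ z * returnGamma ρ k z) := by
  have hbdd : ∀ᵐ z ∂(volume.restrict (Ioi (0 : ℝ))), ‖ψ z‖ ≤ C :=
    (ae_restrict_mem measurableSet_Ioi).mono hC
  have hendpoint : IntegrableOn (fun z => ψ z * (c * returnGamma ρ b z)) (Ioi 0) :=
    (integrableOn_const_mul_returnGamma_endpoint h hb).bdd_mul hψ.aestronglyMeasurable hbdd
  have hdirac : IntegrableOn (fun z => ψ z * (W.dirac * returnGamma ρ 1 z)) (Ioi 0) :=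
    ((h.integrableOn_returnGamma one_pos).const_mul _).bdd_mul hψ.aestronglyMeasurable hbdd
  have hdensity : IntegrableOn
      (fun z => ψ z * ∫ k in Icc 1 b, returnGamma ρ k z * W.g k) (Ioi 0) :=
    (h.integrable_returnGamma_mul_prod (ae_pos_restrict_Icc_one b) hg).integral_prod_right.bdd_mul
      hψ.aestronglyMeasurable hbdd
  have hweight : IntegrableOn (fun z => ψ z * (W.dirac * returnGamma ρ 1 z) +
      ψ z * ∫ k in Icc 1 b, returnGamma ρ k z * W.g k) (Ioi 0) := hdirac.add hdensity
  simp only [netIntegrate, integrate, mul_add]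
  rw [integral_add hendpoint hweight, integral_add hdirac hdensity,
    h.integral_mul_integral_returnGamma (ae_pos_restrict_Icc_one b) hg hψ hbdd]
  simp only [mul_left_comm (ψ _), integral_const_mul]

theorem integral_pos_part_mul_netIntegrate {a x : ℝ} (ha : 0 < a) (hx : x ≤ a) :
    ∫ z in Ioc 0 a, max (z - x) 0 * W.netIntegrate c b (fun k => returnGamma ρ k z) =
      W.netIntegrate c b (fun k => returnPut ρ k x) - W.netIntegrate c b (fun k => returnPut ρ k a)
        - (a - x) * W.netIntegrate c b (fun k => partialMean ρ (k / a)) := by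
  set ψ : ℝ → ℝ := (Iio a).indicator fun z => max (z - x) 0
  have hψ : Measurable ψ := Measurable.indicator (by fun_prop) measurableSet_Iio
  have hbdd : ∀ z, 0 < z → ‖ψ z‖ ≤ a - x := fun z _ => by
    rw [Real.norm_of_nonneg (indicator_nonneg (fun _ _ => le_max_right _ _) _)]
    exact indicator_apply_le' (fun hz => max_le (by linarith [mem_Iio.1 hz]) (by linarith))
      fun _ => by linarith
  have hput : ∀ x, IntegrableOn (fun k => returnPut ρ k x * W.g k) (Icc 1 b) := fun x =>
    integrableOn_continuous_mul hg (h.lipschitz_returnPut x).continuous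
  have hspread : IntegrableOn (fun k => (returnPut ρ k x - returnPut ρ k a) * W.g k) (Icc 1 b) := by
    simpa only [sub_mul] using! (hput x).sub (hput a)
  have hdelta : IntegrableOn (fun k => ((a - x) * partialMean ρ (k / a)) * W.g k) (Icc 1 b) := by
    simpa only [one_mul, mul_assoc] using!
      (h.integrable_partialMean_mul hg 1 a).const_mul (a - x)
  calc ∫ z in Ioc 0 a, max (z - x) 0 * W.netIntegrate c b (fun k => returnGamma ρ k z)
      = ∫ z in Ioi 0, ψ z * W.netIntegrate c b (fun k => returnGamma ρ k z) := by
        rw [integral_Ioc_eq_integral_Ioo, ← Ioi_inter_Iio,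
          ← setIntegral_indicator measurableSet_Iio]
        simp only [ψ, indicator_mul_left]
    _ = W.netIntegrate c b (fun k => ∫ z in Ioi 0, ψ z * returnGamma ρ k z) :=
        integral_mul_netIntegrate_returnGamma h hg hb hψ hbdd
    _ = W.netIntegrate c b (fun k => returnPut ρ k x - returnPut ρ k a
          - (a - x) * partialMean ρ (k / a)) :=
        netIntegrate_congr hb fun k hk =>
          h.integral_pos_part_mul_returnGamma (one_pos.trans_le hk) ha hx
    _ = _ := by
        rw [netIntegrate_sub hspread hdelta, netIntegrate_sub (hput x) (hput a),
          netIntegrate_const_mul]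

end Gamma

section Payoff

variable {ρ : Measure ℝ} (h : IsReturnLaw ρ) (hg : IntegrableOn W.g (Icc 1 b))
include h hg

theorem integrable_integrate_put_payoff (w x : ℝ) :
    Integrable (fun r => W.integrate b (fun k => max (w * k - x * r) 0)) ρ :=
  have := h.toIsProbabilityMeasure
  ((h.integrable_put_payoff _ _).const_mul _).add (h.integrable_put_payoff_mul_prod hg
    (integrableOn_continuous_mul hg continuous_id) w x).integral_prod_right

theorem integral_integrate_put_payoff (w x : ℝ) :
    ∫ r, W.integrate b (fun k => max (w * k - x * r) 0) ∂ρ =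
      W.integrate b (fun k => returnPut ρ (w * k) x) := by
  have := h.toIsProbabilityMeasure
  have hkg := integrableOn_continuous_mul hg continuous_id
  simp only [integrate]
  rw [integral_add ((h.integrable_put_payoff _ _).const_mul _)
      (h.integrable_put_payoff_mul_prod hg hkg w x).integral_prod_right,
    integral_const_mul, h.integral_integral_put_payoff hg hkg]
  rfl

end Payoff

theorem measurable_integrate_put_payoff (hg : IntegrableOn W.g (Icc 1 b)) :
    Measurable (fun p : ℝ × ℝ => W.integrate b (fun k => max (p.1 * k - p.2) 0)) := by
  set g' := hg.aestronglyMeasurable.mk W.g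
  have hg' : Measurable g' := hg.aestronglyMeasurable.stronglyMeasurable_mk.measurable
  have hgg' : ∀ᵐ k ∂(volume.restrict (Icc 1 b)), W.g k = g' k := hg.aestronglyMeasurable.ae_eq_mk
  have hcongr : ∀ p : ℝ × ℝ, ∫ k in Icc 1 b, max (p.1 * k - p.2) 0 * W.g k =
      ∫ k in Icc 1 b, max (p.1 * k - p.2) 0 * g' k := fun p =>
    integral_congr_ae (hgg'.mono fun k hk => by simp only [hk])
  have hmeas : Measurable fun q : (ℝ × ℝ) × ℝ => max (q.1.1 * q.2 - q.1.2) 0 * g' q.2 := by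
    fun_prop
  simp only [integrate, hcongr]
  exact Measurable.add (by fun_prop) hmeas.stronglyMeasurable.integral_prod_right'.measurable

end Weights

/-! ### Option values under a scaling kernel -/

/-- At spot `s > 0` the next price is `s` times a return whose law does not depend on `s`; that law
is the transition law at spot `1`. Nothing is required of the kernel at spots `s ≤ 0`. -/
structure IsScaling (η : Kernel ℝ ℝ) : Prop where
  law : IsReturnLaw (η 1)
  eq_map : ∀ s, 0 < s → η s = (η 1).map (s * ·)

namespace IsScaling

variable {η : Kernel ℝ ℝ} {s : ℝ}

theorem integral_eq (h : IsScaling η) (hs : 0 < s) (f : ℝ → ℝ) :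
    ∫ y, f y ∂(η s) = ∫ r, f (s * r) ∂(η 1) := by
  rw [h.eq_map s hs, (measurableEmbedding_mulLeft₀ hs.ne').integral_map]

theorem integrable_iff (h : IsScaling η) (hs : 0 < s) (f : ℝ → ℝ) :
    Integrable f (η s) ↔ Integrable (fun r => f (s * r)) (η 1) := by
  rw [h.eq_map s hs, (measurableEmbedding_mulLeft₀ hs.ne').integrable_map_iff]
  rfl

theorem integrable_div (h : IsScaling η) (hs : 0 < s) :
    Integrable (fun y => y / s) (η s) := by
  rw [h.integrable_iff hs]
  simpa only [mul_div_cancel_left₀ _ hs.ne'] using h.law.integrable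

theorem integral_norm_div (h : IsScaling η) (hs : 0 < s) :
    ∫ y, ‖y / s‖ ∂(η s) = 1 := by
  simp only [h.integral_eq hs, mul_div_cancel_left₀ _ hs.ne']
  exact (integral_congr_ae (h.law.nonneg.mono fun r hr => Real.norm_of_nonneg hr)).trans h.law.mean

end IsScaling

section ReturnLaw

variable {ρ : Measure ℝ}

theorem IsReturnLaw.integrable_call_payoff (h : IsReturnLaw ρ) (K x : ℝ) :
    Integrable (fun r => max (x * r - K) 0) ρ :=
  have := h.toIsProbabilityMeasure
  ((h.integrable.const_mul x).sub (integrable_const K)).pos_part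

theorem IsReturnLaw.integral_call_payoff (h : IsReturnLaw ρ) (K x : ℝ) :
    ∫ r, max (x * r - K) 0 ∂ρ = x - K + returnPut ρ K x := by
  have := h.toIsProbabilityMeasure
  have hspot := h.integrable.const_mul x
  have hforward : Integrable (fun r => x * r - K) ρ := hspot.sub (integrable_const K)
  simp only [max_sub_zero_eq_sub_add (x * _) K]
  rw [integral_add hforward (h.integrable_put_payoff K x),
    integral_sub hspot (integrable_const K), integral_const_mul, h.mean, returnPut]
  simp

theorem returnPut_mul (ρ : Measure ℝ) {c : ℝ} (hc : 0 ≤ c) (K x : ℝ) :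
    returnPut ρ (c * K) (c * x) = c * returnPut ρ K x := by
  simp only [returnPut, ← integral_const_mul, mul_max_of_nonneg _ _ hc, mul_zero, mul_sub,
    mul_assoc]

end ReturnLaw

namespace IsScaling

variable {κ : ℕ → Kernel ℝ ℝ} {t : ℕ} {K x : ℝ}

theorem put_eq (h : IsScaling (κ t)) (hx : 0 < x) (K : ℝ) :
    put κ t K x = returnPut (κ t 1) K x := h.integral_eq hx _

theorem call_eq (h : IsScaling (κ t)) (hx : 0 < x) (K : ℝ) :
    call κ t K x = x - K + returnPut (κ t 1) K x := by
  rw [call, h.integral_eq hx, h.law.integral_call_payoff]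

theorem hasDerivAt_put (h : IsScaling (κ t)) (hK : 0 < K) (hx : 0 < x) :
    HasDerivAt (put κ t K) (-partialMean (κ t 1) (K / x)) x := by
  refine (h.law.hasDerivAt_returnPut hK hx).congr_of_eventuallyEq ?_
  filter_upwards [Ioi_mem_nhds hx] with z hz using h.put_eq hz K

theorem hasDerivAt_call (h : IsScaling (κ t)) (hK : 0 < K) (hx : 0 < x) :
    HasDerivAt (call κ t K) (1 + -partialMean (κ t 1) (K / x)) x := by
  refine (((hasDerivAt_id x).sub_const K).add
    (h.law.hasDerivAt_returnPut hK hx)).congr_of_eventuallyEq ?_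
  filter_upwards [Ioi_mem_nhds hx] with z hz using h.call_eq hz K

theorem putDelta_eq (h : IsScaling (κ t)) (hK : 0 < K) (hx : 0 < x) :
    putDelta κ t K x = -partialMean (κ t 1) (K / x) :=
  (h.hasDerivAt_put hK hx).deriv

theorem callDelta_eq (h : IsScaling (κ t)) (hK : 0 < K) (hx : 0 < x) :
    callDelta κ t K x = 1 + -partialMean (κ t 1) (K / x) :=
  (h.hasDerivAt_call hK hx).deriv

theorem putDelta_eventuallyEq (h : IsScaling (κ t)) (hK : 0 < K) (hx : 0 < x) :
    putDelta κ t K =ᶠ[nhds x] fun z => -partialMean (κ t 1) (K / z) := by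
  filter_upwards [Ioi_mem_nhds hx] with z hz using h.putDelta_eq hK hz

theorem gamma_eq (h : IsScaling (κ t)) (hK : 0 < K) (hx : 0 < x) :
    gamma κ t K x = returnGamma (κ t 1) K x := by
  rw [← deriv_neg_partialMean_const_div _ hK.ne' hx.ne']
  exact (h.putDelta_eventuallyEq hK hx).deriv_eq

theorem ae_differentiableAt_putDelta (h : IsScaling (κ t)) (hK : 0 < K) :
    ∀ᵐ x ∂(volume.restrict (Ioi (0 : ℝ))), DifferentiableAt ℝ (putDelta κ t K) x := by
  filter_upwards [h.law.ae_differentiableAt_partialMean hK.le, ae_restrict_mem measurableSet_Ioi]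
    with x hx hx0
  exact hx.congr_of_eventuallyEq (h.putDelta_eventuallyEq hK hx0)

end IsScaling

/-! ### The recursion for the weights and the replication of the roll-up -/

section Recursion

variable (κ : ℕ → Kernel ℝ ℝ) (A : ℕ → ℝ) (N t : ℕ)

/-- The number of puts with strike `1 + A_{t+1}` in the portfolio at level `1`, once its calls with
that strike are turned into puts by put–call parity. -/
noncomputable def kinkWeight : ℝ :=
  (weights κ A N t).α / A (t + 1) + (weights κ A N t).β

/-- The part of the portfolio at level `1` that is affine in the fund value `y`, once its calls are
turned into puts by put–call parity. -/
noncomputable def affinePart (y : ℝ) : ℝ :=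
  (weights κ A N t).α * (1 + 1 / A (t + 1) * (y - (1 + A (t + 1))))

/-- The integral of `f` over the strikes of all puts of the portfolio at level `1`, once its calls
are turned into puts by put–call parity. -/
noncomputable def putMix (f : ℝ → ℝ) : ℝ :=
  (weights κ A N t).netIntegrate (kinkWeight κ A N t) (1 + A (t + 1)) f

theorem hedgePayoff_one_eq (y : ℝ) : hedgePayoff κ A N t 1 y =
    affinePart κ A N t y + putMix κ A N t (fun k => max (k - y) 0) := by
  simp only [hedgePayoff, affinePart, putMix, Weights.netIntegrate, kinkWeight, one_mul,
    max_sub_zero_eq_sub_add y]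
  ring

theorem hedgePayoff_mul {c : ℝ} (hc : 0 ≤ c) (w y : ℝ) :
    hedgePayoff κ A N t (c * w) (c * y) = c * hedgePayoff κ A N t w y := by
  have hmax : ∀ u v : ℝ, max (c * u - c * v) 0 = c * max (u - v) 0 := fun u v => by
    rw [mul_max_of_nonneg _ _ hc, mul_sub, mul_zero]
  simp only [hedgePayoff, mul_assoc, hmax, Weights.integrate_const_mul]
  ring

end Recursion

section Replication

variable {κ : ℕ → Kernel ℝ ℝ} {A : ℕ → ℝ} {N t : ℕ}

theorem weights_last (ht : ¬t + 1 < N) :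
    weights κ A N t = { α := 0, β := 0, dirac := 1, g := fun _ => 0 } := by
  rw [weights, dif_neg ht]

theorem hedgePayoff_last (ht : ¬t + 1 < N) (w y : ℝ) : hedgePayoff κ A N t w y = max (w - y) 0 := by
  simp [hedgePayoff, weights_last ht, Weights.integrate]

theorem weights_succ_α (ht : t + 1 < N) :
    (weights κ A N t).α = hedgeValue κ A N (t + 1) 1 (A (t + 1)) := by
  rw [weights, dif_pos ht]
  simp only [hedgeValue, one_mul]

theorem weights_succ_β (ht : t + 1 < N) : (weights κ A N t).β =
    -((weights κ A N (t + 1)).α / A (t + 2)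
        * callDelta κ (t + 1) (1 + A (t + 2)) (A (t + 1))
      + (weights κ A N (t + 1)).β * putDelta κ (t + 1) (1 + A (t + 2)) (A (t + 1))
      + (weights κ A N (t + 1)).integrate (1 + A (t + 2))
          (fun k => putDelta κ (t + 1) k (A (t + 1)))) := by
  rw [weights, dif_pos ht]

theorem weights_succ_dirac (ht : t + 1 < N) : (weights κ A N t).dirac = 0 := by
  rw [weights, dif_pos ht]

theorem weights_succ_g (ht : t + 1 < N) (k : ℝ) :
    (weights κ A N t).g k = putMix κ A N (t + 1) (fun k' => gamma κ (t + 1) k' (k - 1)) := by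
  rw [weights, dif_pos ht]
  rfl

theorem one_le_or_kinkWeight_eq_zero (hA : ∀ t, 1 ≤ t → t < N → 0 < A t) (t : ℕ) :
    1 ≤ 1 + A (t + 1) ∨ kinkWeight κ A N t = 0 := by
  by_cases ht : t + 1 < N
  · exact .inl (by linarith [hA (t + 1) (by omega) ht])
  · exact .inr (by simp [kinkWeight, weights_last ht])

theorem putMix_congr (hA : ∀ t, 1 ≤ t → t < N → 0 < A t) {f f' : ℝ → ℝ}
    (hff : ∀ k, 1 ≤ k → f k = f' k) : putMix κ A N t f = putMix κ A N t f' :=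
  Weights.netIntegrate_congr (one_le_or_kinkWeight_eq_zero hA t) hff

section Model

variable (h : ∀ t < N, IsScaling (κ t))
include h

theorem hedgeValue_one_eq (ht : t < N) {x : ℝ} (hx : 0 < x) : hedgeValue κ A N t 1 x =
    affinePart κ A N t x + putMix κ A N t (fun k => returnPut (κ t 1) k x) := by
  simp only [hedgeValue, affinePart, putMix, Weights.netIntegrate, kinkWeight, one_mul,
    (h t ht).put_eq hx, (h t ht).call_eq hx]
  ring

theorem hedgeValue_mul (ht : t < N) {c w x : ℝ} (hc : 0 < c) (hx : 0 < x) :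
    hedgeValue κ A N t (c * w) (c * x) = c * hedgeValue κ A N t w x := by
  simp only [hedgeValue, (h t ht).put_eq hx, (h t ht).call_eq hx, (h t ht).put_eq (mul_pos hc hx),
    (h t ht).call_eq (mul_pos hc hx), mul_assoc, returnPut_mul _ hc.le,
    Weights.integrate_const_mul]
  ring

variable (hA : ∀ t, 1 ≤ t → t < N → 0 < A t)
include hA

theorem weights_succ_g_add_one (ht : t + 1 < N) {z : ℝ} (hz : 0 < z) :
    (weights κ A N t).g (z + 1) =
      putMix κ A N (t + 1) (fun k => returnGamma (κ (t + 1) 1) k z) := by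
  rw [weights_succ_g ht, add_sub_cancel_right]
  exact putMix_congr hA fun k hk => (h _ ht).gamma_eq (one_pos.trans_le hk) hz

theorem integrableOn_weights_g : ∀ t < N,
    IntegrableOn (weights κ A N t).g (Icc 1 (1 + A (t + 1))) := by
  refine backward_induction fun t _ ih => ?_
  by_cases ht : t + 1 < N
  · have ha := hA (t + 1) (by omega) ht
    have hmix : IntegrableOn
        (fun z => putMix κ A N (t + 1) (fun k => returnGamma (κ (t + 1) 1) k z)) (Ioi 0) :=
      Weights.integrableOn_netIntegrate_returnGamma (h _ ht).law (ih ht)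
        (one_le_or_kinkWeight_eq_zero hA (t + 1))
    have hshift : IntervalIntegrable (fun z => (weights κ A N t).g (z + 1)) volume
        0 (A (t + 1)) := by
      rw [intervalIntegrable_iff_integrableOn_Ioc_of_le ha.le]
      exact (hmix.mono_set Ioc_subset_Ioi_self).congr_fun
        (fun z hz => (weights_succ_g_add_one h hA ht hz.1).symm) measurableSet_Ioc
    rw [integrableOn_Icc_iff_integrableOn_Ioc,
      ← intervalIntegrable_iff_integrableOn_Ioc_of_le (by linarith), add_comm (1 : ℝ)]
    simpa only [sub_add_cancel, zero_add] using hshift.comp_sub_right 1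
  · rw [weights_last ht]
    exact integrableOn_zero

theorem integral_pos_part_mul_weights_g (ht : t + 1 < N) {x : ℝ} (hx : x ≤ A (t + 1)) :
    ∫ k in Icc 1 (1 + A (t + 1)), max (k - (x + 1)) 0 * (weights κ A N t).g k =
      putMix κ A N (t + 1) (fun k => returnPut (κ (t + 1) 1) k x)
        - putMix κ A N (t + 1) (fun k => returnPut (κ (t + 1) 1) k (A (t + 1)))
        - (A (t + 1) - x) *
          putMix κ A N (t + 1) (fun k => partialMean (κ (t + 1) 1) (k / A (t + 1))) := by
  have ha := hA (t + 1) (by omega) ht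
  calc ∫ k in Icc 1 (1 + A (t + 1)), max (k - (x + 1)) 0 * (weights κ A N t).g k
      = ∫ k in (1 : ℝ)..1 + A (t + 1), max (k - (x + 1)) 0 * (weights κ A N t).g k := by
        rw [integral_Icc_eq_integral_Ioc, intervalIntegral.integral_of_le (by linarith)]
    _ = ∫ z in (0 : ℝ)..A (t + 1), max (z + 1 - (x + 1)) 0 * (weights κ A N t).g (z + 1) := by
        rw [intervalIntegral.integral_comp_add_right
          (fun k => max (k - (x + 1)) 0 * (weights κ A N t).g k), zero_add, add_comm (A (t + 1))]
    _ = ∫ z in Ioc 0 (A (t + 1)), max (z - x) 0 *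
          putMix κ A N (t + 1) (fun k => returnGamma (κ (t + 1) 1) k z) := by
        rw [intervalIntegral.integral_of_le ha.le]
        refine setIntegral_congr_fun measurableSet_Ioc fun z hz => ?_
        simp only [weights_succ_g_add_one h hA ht hz.1, add_sub_add_right_eq_sub]
    _ = _ := Weights.integral_pos_part_mul_netIntegrate (h _ ht).law
        (integrableOn_weights_g h hA _ ht) (one_le_or_kinkWeight_eq_zero hA (t + 1)) ha hx

theorem weights_succ_β_eq (ht : t + 1 < N) : (weights κ A N t).β =
    -((weights κ A N (t + 1)).α / A (t + 2)) +
      putMix κ A N (t + 1) (fun k => partialMean (κ (t + 1) 1) (k / A (t + 1))) := by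
  have ha := hA (t + 1) (by omega) ht
  have hstrikes : (weights κ A N (t + 1)).integrate (1 + A (t + 2))
      (fun k => putDelta κ (t + 1) k (A (t + 1))) =
      -(weights κ A N (t + 1)).integrate (1 + A (t + 2))
          (fun k => partialMean (κ (t + 1) 1) (k / A (t + 1))) := by
    rw [← neg_one_mul, ← Weights.integrate_const_mul]
    refine Weights.integrate_congr fun k hk => ?_
    rw [(h _ ht).putDelta_eq (one_pos.trans_le hk) ha, neg_one_mul]
  have hkink : (weights κ A N (t + 1)).α / A (t + 2)
        * callDelta κ (t + 1) (1 + A (t + 2)) (A (t + 1))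
      + (weights κ A N (t + 1)).β * putDelta κ (t + 1) (1 + A (t + 2)) (A (t + 1)) =
      (weights κ A N (t + 1)).α / A (t + 2) - kinkWeight κ A N (t + 1)
        * partialMean (κ (t + 1) 1) ((1 + A (t + 2)) / A (t + 1)) := by
    by_cases ht' : t + 1 + 1 < N
    · have hb : 0 < 1 + A (t + 2) := by linarith [hA (t + 2) (by omega) ht']
      rw [(h _ ht).putDelta_eq hb ha, (h _ ht).callDelta_eq hb ha, kinkWeight]
      ring
    · simp [kinkWeight, weights_last ht']
  rw [weights_succ_β ht, hstrikes, hkink, putMix, Weights.netIntegrate]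
  ring

/- Taylor's formula at `A_{t+1}`, the remainder being the integral of the puts against `g_t`. -/
theorem hedgePayoff_one_add_one (ht : t + 1 < N) {x : ℝ} (hx : x ≤ A (t + 1)) :
    hedgePayoff κ A N t 1 (x + 1) = affinePart κ A N (t + 1) x +
      putMix κ A N (t + 1) (fun k => returnPut (κ (t + 1) 1) k x) := by
  have ha := hA (t + 1) (by omega) ht
  simp only [hedgePayoff, Weights.integrate, weights_succ_dirac ht, one_mul, zero_mul, zero_add]
  rw [integral_pos_part_mul_weights_g h hA ht hx, weights_succ_α ht, weights_succ_β_eq h hA ht,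
    hedgeValue_one_eq h ht ha, max_eq_right (by linarith), max_eq_left (by linarith), affinePart,
    affinePart]
  ring

theorem hedgePayoff_one_of_le_one : ∀ t < N, ∀ y ≤ 1,
    hedgePayoff κ A N t 1 y = (N : ℝ) - t - y := by
  refine backward_induction fun t htN ih y hy => ?_
  by_cases ht : t + 1 < N
  · have ha := hA (t + 1) (by omega) ht
    obtain ⟨x, rfl⟩ : ∃ x, y = x + 1 := ⟨y - 1, by ring⟩
    have hx : x ≤ 0 := by linarith
    have hintrinsic : putMix κ A N (t + 1) (fun k => returnPut (κ (t + 1) 1) k x) =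
        putMix κ A N (t + 1) (fun k => max (k - x) 0) := putMix_congr hA fun k hk => by
      rw [(h _ ht).law.returnPut_of_nonpos (by linarith) hx, max_eq_left (by linarith)]
    rw [hedgePayoff_one_add_one h hA ht (by linarith), hintrinsic, ← hedgePayoff_one_eq,
      ih ht x (by linarith)]
    push_cast
    ring
  · obtain rfl : N = t + 1 := by omega
    simp [hedgePayoff_last ht, hy]

theorem hedgePayoff_of_le (ht : t < N) {w y : ℝ} (hw : 0 < w) (hy : y ≤ w) :
    hedgePayoff κ A N t w y = ((N : ℝ) - t) * w - y := by
  calc hedgePayoff κ A N t w y = w * hedgePayoff κ A N t 1 (y / w) := by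
        rw [← hedgePayoff_mul κ A N t hw.le, mul_one, mul_div_cancel₀ _ hw.ne']
    _ = _ := by
        rw [hedgePayoff_one_of_le_one h hA t ht _ ((div_le_one hw).2 hy)]
        field_simp

theorem hedgePayoff_eq_hedgeValue_of_le (ht : t + 1 < N) {w y : ℝ} (hw : 0 < w) (hwy : w < y)
    (hy : y ≤ w * (1 + A (t + 1))) :
    hedgePayoff κ A N t w y = hedgeValue κ A N (t + 1) w (y - w) := by
  obtain ⟨x, rfl⟩ : ∃ x, y = w * (x + 1) := ⟨y / w - 1, by field_simp; ring⟩
  have hx : 0 < x := by nlinarith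
  have hxa : x ≤ A (t + 1) := by linarith [le_of_mul_le_mul_left hy hw]
  have hmul := hedgeValue_mul (A := A) (w := 1) h ht hw hx
  rw [show w * (x + 1) - w = w * x by ring]
  rw [mul_one] at hmul
  rw [hmul, hedgeValue_one_eq h ht hx, ← hedgePayoff_one_add_one h hA ht hxa,
    ← hedgePayoff_mul κ A N t hw.le, mul_one]

theorem hedgePayoff_eq_hedgeValue_of_ge (ht : t + 1 < N) {w y : ℝ} (hw : 0 < w)
    (hy : w * (1 + A (t + 1)) ≤ y) :
    hedgePayoff κ A N t w y = hedgeValue κ A N (t + 1) ((y - w) / A (t + 1)) (y - w) := by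
  have ha := hA (t + 1) (by omega) ht
  have hputs : ∫ k in Icc 1 (1 + A (t + 1)), max (w * k - y) 0 * (weights κ A N t).g k = 0 := by
    refine setIntegral_eq_zero_of_forall_eq_zero fun k hk => ?_
    rw [max_eq_right (by nlinarith [hk.2]), zero_mul]
  have hmul := hedgeValue_mul (A := A) (w := 1) h ht (c := (y - w) / A (t + 1))
    (div_pos (by nlinarith) ha) ha
  rw [mul_one, div_mul_cancel₀ _ ha.ne'] at hmul
  rw [hmul, ← weights_succ_α ht]
  simp only [hedgePayoff, Weights.integrate, weights_succ_dirac ht, zero_mul, hputs]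
  rw [max_eq_left (by linarith), max_eq_right (by linarith)]
  field_simp
  ring

theorem hedgePayoff_eq_hedgeValue (ht : t + 1 < N) {w y : ℝ} (hw : 0 < w) (hy : w < y) :
    hedgePayoff κ A N t w y =
      hedgeValue κ A N (t + 1) (max w ((y - w) / A (t + 1))) (y - w) := by
  have ha := hA (t + 1) (by omega) ht
  rcases le_total y (w * (1 + A (t + 1))) with hroll | hroll
  · rw [max_eq_left ((div_le_iff₀ ha).2 (by linarith)),
      hedgePayoff_eq_hedgeValue_of_le h hA ht hw hy hroll]
  · rw [max_eq_right ((le_div_iff₀ ha).2 (by linarith)),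
      hedgePayoff_eq_hedgeValue_of_ge h hA ht hw hroll]

theorem measurable_hedgePayoff (ht : t < N) :
    Measurable fun p : ℝ × ℝ => hedgePayoff κ A N t p.1 p.2 := by
  have := Weights.measurable_integrate_put_payoff (integrableOn_weights_g h hA t ht)
  unfold hedgePayoff
  fun_prop

theorem integrable_hedgePayoff (ht : t < N) (w x : ℝ) :
    Integrable (fun r => hedgePayoff κ A N t w (x * r)) (κ t 1) := by
  have hl := (h t ht).law
  have := hl.toIsProbabilityMeasure
  exact ((((integrable_const w).add ((hl.integrable_call_payoff _ x).const_mul _)).const_mul _).add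
    ((hl.integrable_put_payoff _ x).const_mul _)).add
    (Weights.integrable_integrate_put_payoff hl (integrableOn_weights_g h hA t ht) w x)

theorem integral_hedgePayoff (ht : t < N) (w : ℝ) {x : ℝ} (hx : 0 < x) :
    ∫ r, hedgePayoff κ A N t w (x * r) ∂(κ t 1) = hedgeValue κ A N t w x := by
  have hl := (h t ht).law
  have hg := integrableOn_weights_g h hA t ht
  have := hl.toIsProbabilityMeasure
  have hcall := (hl.integrable_call_payoff (w * (1 + A (t + 1))) x).const_mul (1 / A (t + 1))
  have hputs := (hl.integrable_put_payoff (w * (1 + A (t + 1))) x).const_mul (weights κ A N t).β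
  have hlevel : Integrable (fun r => w + 1 / A (t + 1) * max (x * r - w * (1 + A (t + 1))) 0)
      (κ t 1) := (integrable_const w).add hcall
  have hkink : Integrable (fun r => (weights κ A N t).α
        * (w + 1 / A (t + 1) * max (x * r - w * (1 + A (t + 1))) 0)
      + (weights κ A N t).β * max (w * (1 + A (t + 1)) - x * r) 0) (κ t 1) :=
    (hlevel.const_mul _).add hputs
  simp only [hedgePayoff, hedgeValue, (h t ht).put_eq hx, (h t ht).call_eq hx]
  rw [integral_add hkink (Weights.integrable_integrate_put_payoff hl hg w x),
    integral_add (hlevel.const_mul _) hputs, integral_const_mul, integral_const_mul,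
    Weights.integral_integrate_put_payoff hl hg, integral_add (integrable_const w) hcall,
    integral_const_mul, hl.integral_call_payoff]
  simp [returnPut]

theorem integrableOn_put_mul_weights_g (ht : t < N) {x : ℝ} (hx : 0 < x) (w : ℝ) :
    IntegrableOn (fun k => put κ t (w * k) x * (weights κ A N t).g k)
      (Icc 1 (1 + A (t + 1))) := by
  simp only [(h t ht).put_eq hx]
  exact Weights.integrableOn_continuous_mul (integrableOn_weights_g h hA t ht)
    (((h t ht).law.lipschitz_returnPut x).continuous.comp (continuous_const_mul w))

theorem integrableOn_putDelta_mul_weights_g (ht : t < N) {w x : ℝ} (hw : 0 < w) (hx : 0 < x) :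
    IntegrableOn (fun k => putDelta κ t (w * k) x * (weights κ A N t).g k)
      (Icc 1 (1 + A (t + 1))) := by
  refine IntegrableOn.congr_fun ((h t ht).law.integrable_partialMean_mul
    (integrableOn_weights_g h hA t ht) w x).neg (fun k hk => ?_) measurableSet_Icc
  rw [Pi.neg_apply, (h t ht).putDelta_eq (mul_pos hw (one_pos.trans_le hk.1)) hx, neg_mul]

theorem ae_integrableOn_gamma_mul_weights_g (ht : t < N) :
    ∀ᵐ x ∂(volume.restrict (Ioi (0 : ℝ))),
      IntegrableOn (fun k => gamma κ t k x * (weights κ A N t).g k) (Icc 1 (1 + A (t + 1))) := by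
  filter_upwards [((h t ht).law.integrable_returnGamma_mul_prod (Weights.ae_pos_restrict_Icc_one _)
    (integrableOn_weights_g h hA t ht)).prod_left_ae, ae_restrict_mem measurableSet_Ioi]
    with x hx hx0
  refine IntegrableOn.congr_fun hx (fun k hk => ?_) measurableSet_Icc
  simp only [(h t ht).gamma_eq (one_pos.trans_le hk.1) hx0]

end Model

end Replication

/-! ### The value function -/

section ValueFunction

variable {κ : ℕ → Kernel ℝ ℝ} {A : ℕ → ℝ} {N t : ℕ} (h : ∀ t < N, IsScaling (κ t))
include h

/- The alternative `y ≤ w` covers a return `0`, where the next asset price is not positive. -/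
theorem hedgePayoff_mul_return_ae_eq (ht : t < N) {w x s : ℝ}
    (hreplication : ∀ y s, 0 < s ∨ y ≤ w →
      hedgePayoff κ A N t w y = valueFun κ A N (t + 1) w (y - w) s) (hw : 0 < w) (hs : 0 < s) :
    (fun r => hedgePayoff κ A N t w (x * r)) =ᵐ[κ t 1]
      fun r => valueFun κ A N (t + 1) w (x * (s * r / s) - w) (s * r) := by
  filter_upwards [(h t ht).law.nonneg] with r hr
  rw [mul_div_cancel_left₀ _ hs.ne']
  refine hreplication (x * r) (s * r) ?_
  rcases hr.eq_or_lt with rfl | hr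
  · exact .inr (by simpa using hw.le)
  · exact .inl (mul_pos hs hr)

variable (hA : ∀ t, 1 ≤ t → t < N → 0 < A t)
include hA

theorem valueBar_eq_of_replication (ht : t < N) {w x s : ℝ}
    (hreplication : ∀ y s, 0 < s ∨ y ≤ w →
      hedgePayoff κ A N t w y = valueFun κ A N (t + 1) w (y - w) s)
    (hw : 0 < w) (hx : 0 < x) (hs : 0 < s) :
    valueBar κ A N t w x s = hedgeValue κ A N t w x := by
  rw [valueBar, (h t ht).integral_eq hs,
    ← integral_congr_ae (hedgePayoff_mul_return_ae_eq h ht hreplication hw hs),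
    integral_hedgePayoff h hA ht w hx]

theorem hedgePayoff_eq_valueFun : ∀ t < N, ∀ w, 0 < w → ∀ y s, 0 < s ∨ y ≤ w →
    hedgePayoff κ A N t w y = valueFun κ A N (t + 1) w (y - w) s := by
  refine backward_induction fun t htN ih w hw y s hs => ?_
  by_cases hyw : y ≤ w
  · rw [hedgePayoff_of_le h hA htN hw hyw, valueFun, if_pos (by linarith)]
    push_cast
    ring
  · replace hs : 0 < s := hs.resolve_right hyw
    rw [not_le] at hyw
    rw [valueFun, if_neg (by linarith)]
    by_cases ht : t + 1 < N
    · have hroll : 0 < max w ((y - w) / A (t + 1)) := lt_max_of_lt_left hw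
      rw [dif_pos ht, hedgePayoff_eq_hedgeValue h hA ht hw hyw]
      exact (valueBar_eq_of_replication h hA ht (ih ht _ hroll) hroll (by linarith) hs).symm
    · rw [dif_neg ht, hedgePayoff_last ht, max_eq_right (by linarith)]

theorem integrable_valueFun (ht : t < N) {w s : ℝ} (hw : 0 < w) (x : ℝ) (hs : 0 < s) :
    Integrable (fun y => valueFun κ A N (t + 1) w (x * (y / s) - w) y) (κ t s) :=
  ((h t ht).integrable_iff hs _).2 ((integrable_hedgePayoff h hA ht w x).congr
    (hedgePayoff_mul_return_ae_eq h ht (hedgePayoff_eq_valueFun h hA t ht w hw) hw hs))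

theorem valueBar_eq_hedgeValue (ht : t < N) {w x s : ℝ} (hw : 0 < w) (hx : 0 < x) (hs : 0 < s) :
    valueBar κ A N t w x s = hedgeValue κ A N t w x :=
  valueBar_eq_of_replication h hA ht (hedgePayoff_eq_valueFun h hA t ht w hw) hw hx hs

theorem valueBar_mul (ht : t < N) {c w x s : ℝ} (hc : 0 < c) (hw : 0 < w) (hx : 0 < x)
    (hs : 0 < s) : valueBar κ A N t (c * w) (c * x) s = c * valueBar κ A N t w x s := by
  rw [valueBar_eq_hedgeValue h hA ht (mul_pos hc hw) (mul_pos hc hx) hs,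
    valueBar_eq_hedgeValue h hA ht hw hx hs, hedgeValue_mul h ht hc hx]

end ValueFunction

/-! ### The market -/

namespace AssumptionA1

variable {Ω : Type*} {m : MeasurableSpace Ω} {Q : Measure Ω} {ℱ : Filtration ℕ m}
  {S : ℕ → Ω → ℝ} {κ : ℕ → Kernel ℝ ℝ} {N t : ℕ}

theorem ae_nonneg (hA1 : AssumptionA1 Q ℱ S κ N) (ht : t < N) {s : ℝ} (hs : 0 ≤ s) :
    ∀ᵐ y ∂(κ t s), 0 ≤ y := by
  simpa [ae_iff, Iio] using hA1.nonneg t ht s hs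

theorem eq_map_mul [∀ t, IsMarkovKernel (κ t)] (hA1 : AssumptionA1 Q ℱ S κ N)
    (hA2 : AssumptionA2 κ N) (ht : t < N) {s : ℝ} (hs : 0 < s) :
    κ t s = (κ t 1).map (s * ·) :=
  eq_map_mul_of_integral_put_eq (hA1.ae_nonneg ht hs.le) (hA1.ae_nonneg ht zero_le_one) hs
    fun K hK => by simpa only [put, mul_one] using hA2 t ht s hs K hK 1 one_pos

variable [IsProbabilityMeasure Q]

theorem price_nonneg (hA1 : AssumptionA1 Q ℱ S κ N) (hS : Adapted ℱ S)
    (hS0 : ∀ᵐ ω ∂Q, 0 ≤ S 0 ω) (ht : t ≤ N) : ∀ᵐ ω ∂Q, 0 ≤ S t ω := by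
  induction t with
  | zero => exact hS0
  | succ t ih =>
    have hmeas : MeasurableSet (S (t + 1) ⁻¹' Iio 0) :=
      ℱ.le (t + 1) _ (hS (t + 1) measurableSet_Iio)
    have hzero : ∫ ω, (κ t (S t ω)).real (Iio 0) ∂Q = 0 := by
      refine integral_eq_zero_of_ae ?_
      filter_upwards [ih (by omega)] with ω hω
      simp [Measure.real, hA1.nonneg t ht _ hω]
    have hprob : Q.real (S (t + 1) ⁻¹' Iio 0) = 0 := by
      rwa [← integral_congr_ae (hA1.markov t ht _ measurableSet_Iio),
        integral_condExp (ℱ.le t), integral_indicator_const _ hmeas, smul_eq_mul,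
        mul_one] at hzero
    simpa [ae_iff, preimage] using (measureReal_eq_zero_iff).1 hprob

variable [∀ t, IsMarkovKernel (κ t)]

/- The state space is `Ω` with the σ-algebra `ℱ t`, so that integrands may depend on the whole past
up to date `t`. -/
theorem map_prodMk_next_price (hA1 : AssumptionA1 Q ℱ S κ N) (hS : Adapted ℱ S) (ht : t < N) :
    @Measure.map Ω (Ω × ℝ) m ((ℱ t).prod inferInstance) (fun ω => (ω, S (t + 1) ω)) Q =
      @Measure.compProd Ω ℝ (ℱ t) _ (@Measure.map Ω Ω m (ℱ t) id Q)
        (@Kernel.comap ℝ ℝ _ _ Ω (ℱ t) (κ t) (S t) (hS t)) :=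
  @map_prodMk_eq_compProd_of_condExp_indicator Ω Ω ℝ m (ℱ t) _ Q _ id (S (t + 1)) _
    (@Kernel.IsMarkovKernel.comap ℝ ℝ _ _ Ω (ℱ t) (S t) (κ t) _ (hS t)) (ℱ.le t)
    ((hS (t + 1)).mono (ℱ.le _) le_rfl)
    (by rw [MeasurableSpace.comap_id]; exact hA1.markov t ht)

theorem condExp_comp_next_price (hA1 : AssumptionA1 Q ℱ S κ N) (hS : Adapted ℱ S) (ht : t < N)
    {F : Ω × ℝ → ℝ} (hF : StronglyMeasurable[(ℱ t).prod inferInstance] F)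
    (hi : Integrable (fun ω => F (ω, S (t + 1) ω)) Q) :
    Q[fun ω => F (ω, S (t + 1) ω) | ℱ t] =ᵐ[Q] fun ω => ∫ y, F (ω, y) ∂(κ t (S t ω)) := by
  have hcond := @condExp_comp_prodMk_ae_eq_integral_kernel Ω Ω ℝ ℝ m (ℱ t) _ Q _ id (S (t + 1))
    _ _ F _ _ _ _ _ (ℱ.le t) ((hS (t + 1)).mono (ℱ.le _) le_rfl)
    (hA1.map_prodMk_next_price hS ht) hF hi
  rwa [MeasurableSpace.comap_id] at hcond

theorem integrable_comp_next_price_iff (hA1 : AssumptionA1 Q ℱ S κ N) (hS : Adapted ℱ S)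
    (ht : t < N) {F : Ω × ℝ → ℝ} (hF : StronglyMeasurable[(ℱ t).prod inferInstance] F) :
    Integrable (fun ω => F (ω, S (t + 1) ω)) Q ↔
      (∀ᵐ ω ∂Q, Integrable (fun y => F (ω, y)) (κ t (S t ω))) ∧
      Integrable (fun ω => ∫ y, ‖F (ω, y)‖ ∂(κ t (S t ω))) Q := by
  have hiff := @integrable_comp_prodMk_iff_kernel Ω Ω ℝ ℝ m (ℱ t) _ Q _ id (S (t + 1)) _ _ F _
    (ℱ.le t) ((hS (t + 1)).mono (ℱ.le _) le_rfl) (hA1.map_prodMk_next_price hS ht) hF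
  exact hiff

theorem integrable_and_integral_kernel_eq_price (hA1 : AssumptionA1 Q ℱ S κ N)
    (hS : Martingale S ℱ Q) (ht : t < N) :
    ∀ᵐ ω ∂Q, Integrable (fun y => y) (κ t (S t ω)) ∧ ∫ y, y ∂(κ t (S t ω)) = S t ω := by
  have hadapted := hS.1.adapted
  have hsnd : StronglyMeasurable[(ℱ t).prod inferInstance] (Prod.snd : Ω × ℝ → ℝ) :=
    (@measurable_snd Ω ℝ (ℱ t) _).stronglyMeasurable
  have hnext := hS.integrable (t + 1)
  filter_upwards [((hA1.integrable_comp_next_price_iff hadapted ht hsnd).1 hnext).1,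
    hA1.condExp_comp_next_price hadapted ht hsnd hnext, hS.2 t (t + 1) t.le_succ]
    with ω hint hcond hmart
  exact ⟨hint, hcond.symm.trans hmart⟩

theorem isScaling (hA1 : AssumptionA1 Q ℱ S κ N) (hA2 : AssumptionA2 κ N)
    (hS : Martingale S ℱ Q) (hS0 : 0 < ∫ ω, S 0 ω ∂Q) (ht : t < N) : IsScaling (κ t) where
  eq_map _ hs := hA1.eq_map_mul hA2 ht hs
  law := by
    have hpos : ∃ᵐ ω ∂Q, 0 < S t ω := by
      intro hnonpos
      have hmean : ∫ ω, S t ω ∂Q ≤ 0 :=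
        integral_nonpos_of_ae (hnonpos.mono fun ω hω => not_lt.1 hω)
      rw [← setIntegral_univ, ← hS.setIntegral_eq t.zero_le MeasurableSet.univ,
        setIntegral_univ] at hmean
      exact hmean.not_gt hS0
    obtain ⟨ω, hω, hint, hmean⟩ :=
      (hpos.and_eventually (hA1.integrable_and_integral_kernel_eq_price hS ht)).exists
    rw [hA1.eq_map_mul hA2 ht hω] at hint hmean
    exact isReturnLaw_of_map_mul hω (hA1.ae_nonneg ht zero_le_one) hint hmean
      (hA1.continuous t ht 1 one_pos)

theorem integrable_mul_price_ratio (hA1 : AssumptionA1 Q ℱ S κ N) (h : IsScaling (κ t))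
    (hS : Adapted ℱ S) (ht : t < N) (hprice : ∀ᵐ ω ∂Q, 0 ≤ S t ω) {Y : Ω → ℝ}
    (hY : Measurable[ℱ t] Y) (hi : Integrable Y Q) :
    Integrable (fun ω => Y ω * (S (t + 1) ω / S t ω)) Q := by
  have hF : Measurable[(ℱ t).prod inferInstance]
      (fun p : Ω × ℝ => Y p.1 * (p.2 / S t p.1)) :=
    (hY.comp (@measurable_fst Ω ℝ (ℱ t) _)).mul ((@measurable_snd Ω ℝ (ℱ t) _).div
      ((hS t).comp (@measurable_fst Ω ℝ (ℱ t) _)))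
  refine (hA1.integrable_comp_next_price_iff hS ht hF.stronglyMeasurable).2 ⟨?_, ?_⟩
  · filter_upwards [hprice] with ω hω
    rcases hω.eq_or_lt with hzero | hpos
    · simp [← hzero]
    · exact (h.integrable_div hpos).const_mul (Y ω)
  · have hmeas : MeasurableSet {ω | S t ω ≠ 0} :=
      ℱ.le t _ (hS t (measurableSet_singleton 0)).compl
    refine (hi.norm.indicator hmeas).congr ?_
    filter_upwards [hprice] with ω hω
    rcases hω.eq_or_lt with hzero | hpos
    · simp [← hzero]
    · simp only [norm_mul, integral_const_mul, h.integral_norm_div hpos, mul_one]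
      exact indicator_of_mem (s := {ω | S t ω ≠ 0}) hpos.ne' _

end AssumptionA1

/-! ### The fund and its depletion -/

section Paths

variable {Ω : Type*} {S : ℕ → Ω → ℝ} {A : ℕ → ℝ} {N t : ℕ} {x₀ w₀ : ℝ} {ω : Ω}

theorem fund_succ (t : ℕ) (ω : Ω) : fund S A N x₀ w₀ (t + 1) ω =
    fund S A N x₀ w₀ t ω * (S (t + 1) ω / S t ω) - level S A N x₀ w₀ t ω := rfl

theorem level_succ (t : ℕ) (ω : Ω) : level S A N x₀ w₀ (t + 1) ω =
    if t + 1 < N then max (level S A N x₀ w₀ t ω) (fund S A N x₀ w₀ (t + 1) ω / A (t + 1))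
      else level S A N x₀ w₀ t ω := rfl

theorem level_pos (hw₀ : 0 < w₀) (t : ℕ) (ω : Ω) : 0 < level S A N x₀ w₀ t ω := by
  induction t with
  | zero => exact hw₀
  | succ t ih =>
    rw [level_succ]
    split_ifs
    · exact lt_max_of_lt_left ih
    · exact ih

theorem level_succ_of_fund_nonpos (hA : ∀ t, 1 ≤ t → t < N → 0 < A t) (hw₀ : 0 < w₀)
    (hX : fund S A N x₀ w₀ (t + 1) ω ≤ 0) :
    level S A N x₀ w₀ (t + 1) ω = level S A N x₀ w₀ t ω := by
  rw [level_succ]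
  split_ifs with ht
  · exact max_eq_left ((div_nonpos_of_nonpos_of_nonneg hX (hA _ (by omega) ht).le).trans
      (level_pos hw₀ t ω).le)
  · rfl

/-- The event that the fund is not depleted up to date `t`; for `t ≤ N` it is `{t < τ}`. -/
def alive (S : ℕ → Ω → ℝ) (A : ℕ → ℝ) (N : ℕ) (x₀ w₀ : ℝ) (t : ℕ) : Set Ω :=
  {ω | ∀ u ≤ t, 0 < fund S A N x₀ w₀ u ω}

theorem mem_alive_succ : ω ∈ alive S A N x₀ w₀ (t + 1) ↔
    ω ∈ alive S A N x₀ w₀ t ∧ 0 < fund S A N x₀ w₀ (t + 1) ω := by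
  simp only [alive, mem_ofPred_eq, ← Nat.lt_succ_iff]
  exact Nat.forall_lt_succ_right

theorem lt_depletionTime_iff (ht : t ≤ N) :
    (t : ℕ∞) < depletionTime S A N x₀ w₀ ω ↔ ω ∈ alive S A N x₀ w₀ t := by
  rw [← ENat.add_one_le_iff (ENat.natCast_ne_top t), depletionTime, le_sInf_iff]
  simp only [forall_mem_image, mem_ofPred_eq, alive]
  norm_cast
  exact ⟨fun hτ u hut => not_le.1 fun hX => absurd (hτ ⟨hut.trans ht, hX⟩) (by omega),
    fun hω u hu => not_lt.1 fun hut => hu.2.not_gt (hω u (Nat.lt_succ_iff.1 hut))⟩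

theorem depletionTime_le_iff (ht : t ≤ N) :
    depletionTime S A N x₀ w₀ ω ≤ t ↔ ω ∉ alive S A N x₀ w₀ t := by
  rw [← not_lt, lt_depletionTime_iff ht]

theorem depletionTime_eq_succ_iff (ht : t < N) :
    depletionTime S A N x₀ w₀ ω = (t + 1 : ℕ) ↔
      ω ∈ alive S A N x₀ w₀ t ∧ fund S A N x₀ w₀ (t + 1) ω ≤ 0 := by
  rw [le_antisymm_iff, depletionTime_le_iff ht, Nat.cast_succ,
    ENat.add_one_le_iff (ENat.natCast_ne_top t), lt_depletionTime_iff ht.le, mem_alive_succ,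
    ← not_lt]
  tauto

open Classical in
theorem claim_succ (ht : t < N) (ω : Ω) : claim S A N x₀ w₀ (t + 1) ω =
    (alive S A N x₀ w₀ t)ᶜ.indicator (level S A N x₀ w₀ t) ω +
    (alive S A N x₀ w₀ t ∩ {ω | fund S A N x₀ w₀ (t + 1) ω ≤ 0}).indicator
      (-fund S A N x₀ w₀ (t + 1)) ω := by
  simp only [claim, depletionTime_le_iff ht.le, depletionTime_eq_succ_iff ht, indicator_apply,
    mem_compl_iff, mem_inter_iff, mem_ofPred_eq, Pi.neg_apply]
  congr 1
  exact ite_congr rfl (fun hX => by rw [min_eq_right hX.2]) fun _ => rfl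

theorem claim_of_mem_alive (ht : t ≤ N) (hω : ω ∈ alive S A N x₀ w₀ t) :
    claim S A N x₀ w₀ t ω = 0 := by
  cases t with
  | zero => rfl
  | succ t =>
    obtain ⟨halive, hX⟩ := mem_alive_succ.1 hω
    simp [claim_succ ht, halive, hX]

theorem claim_succ_of_depleting (ht : t < N) (hω : ω ∈ alive S A N x₀ w₀ t)
    (hX : fund S A N x₀ w₀ (t + 1) ω ≤ 0) :
    claim S A N x₀ w₀ (t + 1) ω = -fund S A N x₀ w₀ (t + 1) ω := by
  simp [claim_succ ht, hω, hX]

theorem claim_succ_of_notMem_alive (ht : t < N) (hω : ω ∉ alive S A N x₀ w₀ t) :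
    claim S A N x₀ w₀ (t + 1) ω = level S A N x₀ w₀ t ω := by
  simp [claim_succ ht, hω]

theorem sum_claim_eq_add (ht : t ≤ N) : ∑ u ∈ Finset.Icc t N, claim S A N x₀ w₀ u ω =
    claim S A N x₀ w₀ t ω + ∑ u ∈ Finset.Icc (t + 1) N, claim S A N x₀ w₀ u ω := by
  rw [← Finset.insert_Icc_add_one_left_eq_Icc ht, Finset.sum_insert (by simp)]

theorem price_ne_zero_of_mem_alive (hw₀ : 0 < w₀) (hS0 : S 0 ω ≠ 0)
    (hω : ω ∈ alive S A N x₀ w₀ t) : S t ω ≠ 0 := by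
  cases t with
  | zero => exact hS0
  | succ t =>
    intro hzero
    have hX := (mem_alive_succ.1 hω).2
    rw [fund_succ, hzero, zero_div, mul_zero, zero_sub, neg_pos] at hX
    exact hX.not_gt (level_pos hw₀ t ω)

theorem fund_nonpos_of_notMem_alive (hw₀ : 0 < w₀) (hS : ∀ t ≤ N, 0 ≤ S t ω) (ht : t ≤ N)
    (hω : ω ∉ alive S A N x₀ w₀ t) : fund S A N x₀ w₀ t ω ≤ 0 := by
  induction t with
  | zero => simpa [alive] using hω
  | succ t ih =>
    by_contra! hX
    have hprev : fund S A N x₀ w₀ t ω ≤ 0 :=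
      ih (by omega) fun halive => hω (mem_alive_succ.2 ⟨halive, hX⟩)
    have hgrowth := mul_nonpos_of_nonpos_of_nonneg hprev
      (div_nonneg (hS (t + 1) ht) (hS t (by omega)))
    have hw : 0 < level S A N x₀ w₀ t ω := level_pos hw₀ t ω
    rw [fund_succ] at hX
    linarith

theorem sum_claim_of_notMem_alive (hA : ∀ t, 1 ≤ t → t < N → 0 < A t) (hw₀ : 0 < w₀)
    (hS : ∀ t ≤ N, 0 ≤ S t ω) (ht : t ≤ N) (hω : ω ∉ alive S A N x₀ w₀ t) :
    ∑ u ∈ Finset.Icc (t + 1) N, claim S A N x₀ w₀ u ω =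
      ((N : ℝ) - t) * level S A N x₀ w₀ t ω := by
  induction ht using Nat.decreasingInduction with
  | self => simp
  | of_succ t ht ih =>
    have hdead : ω ∉ alive S A N x₀ w₀ (t + 1) := fun halive => hω (mem_alive_succ.1 halive).1
    rw [sum_claim_eq_add ht, ih hdead, claim_succ_of_notMem_alive ht hω,
      level_succ_of_fund_nonpos hA hw₀ (fund_nonpos_of_notMem_alive hw₀ hS ht hdead)]
    push_cast
    ring

theorem sum_claim_of_depleting (hA : ∀ t, 1 ≤ t → t < N → 0 < A t) (hw₀ : 0 < w₀)
    (hS : ∀ t ≤ N, 0 ≤ S t ω) (ht : t < N) (hω : ω ∈ alive S A N x₀ w₀ t)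
    (hX : fund S A N x₀ w₀ (t + 1) ω ≤ 0) :
    ∑ u ∈ Finset.Icc (t + 1) N, claim S A N x₀ w₀ u ω =
      ((N : ℝ) - t - 1) * level S A N x₀ w₀ t ω - fund S A N x₀ w₀ (t + 1) ω := by
  have hdead : ω ∉ alive S A N x₀ w₀ (t + 1) := fun halive => (mem_alive_succ.1 halive).2.not_ge hX
  rw [sum_claim_eq_add ht, sum_claim_of_notMem_alive hA hw₀ hS ht hdead,
    claim_succ_of_depleting ht hω hX, level_succ_of_fund_nonpos hA hw₀ hX]
  push_cast
  ring

variable {m : MeasurableSpace Ω} {ℱ : Filtration ℕ m}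

theorem measurable_fundPair (hS : Adapted ℱ S) (t : ℕ) :
    Measurable[ℱ t] (fundPair S A N x₀ w₀ t) := by
  induction t with
  | zero => exact measurable_const
  | succ t ih =>
    have hmono := ℱ.mono t.le_succ
    replace ih := ih.mono hmono le_rfl
    have hX : Measurable[ℱ (t + 1)] (fund S A N x₀ w₀ (t + 1)) :=
      (ih.fst.mul ((hS (t + 1)).div ((hS t).mono hmono le_rfl))).sub ih.snd
    refine hX.prodMk ?_
    by_cases ht : t + 1 < N
    · simp only [ht, if_true]
      exact ih.snd.max (hX.div_const _)
    · simp only [ht, if_false]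
      exact ih.snd

theorem measurableSet_alive (hS : Adapted ℱ S) (t : ℕ) :
    MeasurableSet[ℱ t] (alive S A N x₀ w₀ t) := by
  rw [show alive S A N x₀ w₀ t = ⋂ u ≤ t, fund S A N x₀ w₀ u ⁻¹' Ioi 0 by ext; simp [alive]]
  exact .biInter (to_countable _) fun u hu =>
    ℱ.mono hu _ ((measurable_fundPair hS u).fst measurableSet_Ioi)

end Paths

/-! ### The value process -/

section ValueProcess

variable {Ω : Type*} {m : MeasurableSpace Ω} {Q : Measure Ω} [IsProbabilityMeasure Q]
  {ℱ : Filtration ℕ m} {S : ℕ → Ω → ℝ} {κ : ℕ → Kernel ℝ ℝ} [∀ t, IsMarkovKernel (κ t)]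
  {A : ℕ → ℝ} {N t : ℕ} {x₀ w₀ : ℝ} (hA1 : AssumptionA1 Q ℱ S κ N) (hS : Adapted ℱ S)
  (h : ∀ t < N, IsScaling (κ t))
include hA1 hS h

theorem integrable_fundPair (hS0 : ∀ᵐ ω ∂Q, 0 ≤ S 0 ω) (ht : t ≤ N) :
    Integrable (fundPair S A N x₀ w₀ t) Q := by
  induction t with
  | zero => exact integrable_const _
  | succ t ih =>
    replace ih := ih (by omega)
    have hX : Integrable (fund S A N x₀ w₀ (t + 1)) Q :=
      (hA1.integrable_mul_price_ratio (h t ht) hS ht (hA1.price_nonneg hS hS0 (by omega))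
        (measurable_fundPair hS t).fst ih.fst).sub ih.snd
    refine hX.prodMk ?_
    by_cases ht : t + 1 < N
    · simp only [ht, if_true]
      exact ih.snd.sup (hX.div_const _)
    · simp only [ht, if_false]
      exact ih.snd

theorem integrable_claim (hS0 : ∀ᵐ ω ∂Q, 0 ≤ S 0 ω) (ht : t ≤ N) :
    Integrable (claim S A N x₀ w₀ t) Q := by
  cases t with
  | zero => exact integrable_const (0 : ℝ)
  | succ t =>
    have halive : MeasurableSet (alive S A N x₀ w₀ t) := ℱ.le t _ (measurableSet_alive hS t)
    have hdepleted : MeasurableSet {ω | fund S A N x₀ w₀ (t + 1) ω ≤ 0} :=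
      ℱ.le (t + 1) _ ((measurable_fundPair hS (t + 1)).fst measurableSet_Iic)
    rw [funext (claim_succ ht)]
    exact ((integrable_fundPair hA1 hS h hS0 (by omega)).snd.indicator halive.compl).add
      ((integrable_fundPair hA1 hS h hS0 ht).fst.neg.indicator (halive.inter hdepleted))

theorem integrable_sum_claim (hS0 : ∀ᵐ ω ∂Q, 0 ≤ S 0 ω) (t : ℕ) :
    Integrable (fun ω => ∑ u ∈ Finset.Icc t N, claim S A N x₀ w₀ u ω) Q :=
  integrable_finsetSum _ fun _ hu => integrable_claim hA1 hS h hS0 (Finset.mem_Icc.1 hu).2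

theorem valueProcess_eq_condExp_succ (hS0 : ∀ᵐ ω ∂Q, 0 ≤ S 0 ω) (ht : t < N) :
    ∀ᵐ ω ∂Q, ω ∈ alive S A N x₀ w₀ t → valueProcess Q ℱ S A N x₀ w₀ t ω =
      (Q[valueProcess Q ℱ S A N x₀ w₀ (t + 1) | ℱ t]) ω := by
  have hdrop := condExp_eq_on_of_ae_eq (measurableSet_alive hS t)
    (integrable_sum_claim hA1 hS h hS0 (A := A) (x₀ := x₀) (w₀ := w₀) t)
    (integrable_sum_claim hA1 hS h hS0 (t + 1))
    (.of_forall fun ω hω => by rw [sum_claim_eq_add ht.le, claim_of_mem_alive ht.le hω, zero_add])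
  have htower := condExp_condExp_of_le (μ := Q) (ℱ.mono t.le_succ) (ℱ.le (t + 1))
    (f := fun ω => ∑ u ∈ Finset.Icc (t + 1) N, claim S A N x₀ w₀ u ω)
  filter_upwards [hdrop, htower] with ω hdrop htower hω
  exact (hdrop hω).trans htower.symm

theorem valueProcess_succ_of_depleting (hA : ∀ t, 1 ≤ t → t < N → 0 < A t) (hw₀ : 0 < w₀)
    (hS0 : ∀ᵐ ω ∂Q, 0 ≤ S 0 ω) (ht : t < N) :
    ∀ᵐ ω ∂Q, ω ∈ alive S A N x₀ w₀ t ∩ {ω | fund S A N x₀ w₀ (t + 1) ω ≤ 0} →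
      valueProcess Q ℱ S A N x₀ w₀ (t + 1) ω =
        ((N : ℝ) - t - 1) * level S A N x₀ w₀ t ω - fund S A N x₀ w₀ (t + 1) ω := by
  have hmono := ℱ.mono t.le_succ
  have hfund : Measurable[ℱ (t + 1)] (fund S A N x₀ w₀ (t + 1)) :=
    (measurable_fundPair hS (t + 1)).fst
  have hlevel : Measurable[ℱ (t + 1)] (level S A N x₀ w₀ t) :=
    (measurable_fundPair hS t).snd.mono hmono le_rfl
  have hpath : ∀ᵐ ω ∂Q, ∀ u ≤ N, 0 ≤ S u ω := by
    simpa only [ae_all_iff] using fun u hu => hA1.price_nonneg hS hS0 hu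
  have hvalue : Integrable (fun ω => ((N : ℝ) - t - 1) * level S A N x₀ w₀ t ω -
      fund S A N x₀ w₀ (t + 1) ω) Q :=
    ((integrable_fundPair hA1 hS h hS0 ht.le).snd.const_mul _).sub
      (integrable_fundPair hA1 hS h hS0 ht).fst
  have hknown := condExp_eq_on_of_ae_eq
    ((hmono _ (measurableSet_alive hS t)).inter (hfund measurableSet_Iic))
    (integrable_sum_claim hA1 hS h hS0 (t + 1)) hvalue
    (hpath.mono fun ω hω hdepleting =>
      sum_claim_of_depleting hA hw₀ hω ht hdepleting.1 hdepleting.2)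
  have hmeas : Measurable[ℱ (t + 1)] fun ω =>
      ((N : ℝ) - t - 1) * level S A N x₀ w₀ t ω - fund S A N x₀ w₀ (t + 1) ω :=
    (hlevel.const_mul _).sub hfund
  rw [condExp_of_stronglyMeasurable (ℱ.le _) hmeas.stronglyMeasurable hvalue] at hknown
  exact hknown

theorem valueProcess_maturity_eq_zero (hS0 : ∀ᵐ ω ∂Q, 0 ≤ S 0 ω) :
    ∀ᵐ ω ∂Q, ω ∈ alive S A N x₀ w₀ N → valueProcess Q ℱ S A N x₀ w₀ N ω = 0 := by
  have hzero := condExp_eq_on_of_ae_eq (g := 0)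
    (measurableSet_alive (A := A) (N := N) (x₀ := x₀) (w₀ := w₀) hS N)
    (integrable_sum_claim hA1 hS h hS0 N) (integrable_zero _ _ _)
    (.of_forall fun ω hω => by simpa using claim_of_mem_alive le_rfl hω)
  rw [condExp_zero] at hzero
  exact hzero

theorem condExp_indicator_hedgePayoff_eq_hedgeValue (hA : ∀ t, 1 ≤ t → t < N → 0 < A t)
    (hw₀ : 0 < w₀) (hS0 : ∀ᵐ ω ∂Q, 0 < S 0 ω) (ht : t < N)
    (hi : Integrable ((alive S A N x₀ w₀ t).indicator fun ω =>
      hedgePayoff κ A N t (level S A N x₀ w₀ t ω)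
        (fund S A N x₀ w₀ (t + 1) ω + level S A N x₀ w₀ t ω)) Q) :
    ∀ᵐ ω ∂Q, ω ∈ alive S A N x₀ w₀ t →
      (Q[(alive S A N x₀ w₀ t).indicator fun ω => hedgePayoff κ A N t (level S A N x₀ w₀ t ω)
        (fund S A N x₀ w₀ (t + 1) ω + level S A N x₀ w₀ t ω) | ℱ t]) ω =
      hedgeValue κ A N t (level S A N x₀ w₀ t ω) (fund S A N x₀ w₀ t ω) := by
  let F : Ω × ℝ → ℝ := (Prod.fst ⁻¹' alive S A N x₀ w₀ t).indicator fun p =>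
    hedgePayoff κ A N t (level S A N x₀ w₀ t p.1) (fund S A N x₀ w₀ t p.1 * (p.2 / S t p.1))
  have hF : Measurable[(ℱ t).prod inferInstance] F := by
    have hfst := @measurable_fst Ω ℝ (ℱ t) inferInstance
    have hsnd := @measurable_snd Ω ℝ (ℱ t) inferInstance
    have hpair := (measurable_fundPair (A := A) (N := N) (x₀ := x₀) (w₀ := w₀) hS t).comp hfst
    exact ((measurable_hedgePayoff h hA ht).comp (hpair.snd.prodMk
      (hpair.fst.mul (hsnd.div ((hS t).comp hfst))))).indicator (hfst (measurableSet_alive hS t))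
  have hpayoff : ((alive S A N x₀ w₀ t).indicator fun ω =>
      hedgePayoff κ A N t (level S A N x₀ w₀ t ω)
        (fund S A N x₀ w₀ (t + 1) ω + level S A N x₀ w₀ t ω)) = fun ω => F (ω, S (t + 1) ω) := by
    simp only [fund_succ, sub_add_cancel]
    rfl
  rw [hpayoff] at hi ⊢
  filter_upwards [hA1.condExp_comp_next_price hS ht hF.stronglyMeasurable hi, hS0,
    hA1.price_nonneg hS (hS0.mono fun _ => le_of_lt) ht.le] with ω hcond hS0 hprice hω
  replace hprice := hprice.lt_of_ne' (price_ne_zero_of_mem_alive hw₀ hS0.ne' hω)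
  have hFω : ∀ r, F (ω, S t ω * r) =
      hedgePayoff κ A N t (level S A N x₀ w₀ t ω) (fund S A N x₀ w₀ t ω * r) := fun r => by
    rw [show F (ω, S t ω * r) = _ from indicator_of_mem (mem_preimage.2 hω) _,
      mul_div_cancel_left₀ _ hprice.ne']
  rw [hcond, (h t ht).integral_eq hprice, ← integral_hedgePayoff h hA ht _ (hω t le_rfl)]
  simp only [hFω]

theorem valueProcess_succ_eq_hedgePayoff (hA : ∀ t, 1 ≤ t → t < N → 0 < A t) (hw₀ : 0 < w₀)
    (hS0 : ∀ᵐ ω ∂Q, 0 ≤ S 0 ω) (ht : t < N)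
    (hnext : t + 1 < N → ∀ᵐ ω ∂Q, ω ∈ alive S A N x₀ w₀ (t + 1) →
      valueProcess Q ℱ S A N x₀ w₀ (t + 1) ω =
        hedgeValue κ A N (t + 1) (level S A N x₀ w₀ (t + 1) ω) (fund S A N x₀ w₀ (t + 1) ω)) :
    ∀ᵐ ω ∂Q, ω ∈ alive S A N x₀ w₀ t →
      valueProcess Q ℱ S A N x₀ w₀ (t + 1) ω = hedgePayoff κ A N t (level S A N x₀ w₀ t ω)
        (fund S A N x₀ w₀ (t + 1) ω + level S A N x₀ w₀ t ω) := by
  have hsurviving : ∀ᵐ ω ∂Q, ω ∈ alive S A N x₀ w₀ (t + 1) →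
      valueProcess Q ℱ S A N x₀ w₀ (t + 1) ω = hedgePayoff κ A N t (level S A N x₀ w₀ t ω)
        (fund S A N x₀ w₀ (t + 1) ω + level S A N x₀ w₀ t ω) := by
    by_cases htN : t + 1 < N
    · filter_upwards [hnext htN] with ω hω halive
      rw [hω halive, hedgePayoff_eq_hedgeValue h hA htN (level_pos hw₀ t ω)
        (lt_add_of_pos_left _ (mem_alive_succ.1 halive).2), add_sub_cancel_right, level_succ,
        if_pos htN]
    · obtain rfl : N = t + 1 := by omega
      filter_upwards [valueProcess_maturity_eq_zero hA1 hS h hS0] with ω hω halive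
      rw [hω halive, hedgePayoff_last htN, max_eq_right (by linarith [(mem_alive_succ.1 halive).2])]
  filter_upwards [hsurviving, valueProcess_succ_of_depleting hA1 hS h hA hw₀ hS0 ht]
    with ω hsurviving hdepleting hω
  rcases le_or_gt (fund S A N x₀ w₀ (t + 1) ω) 0 with hX | hX
  · rw [hdepleting ⟨hω, hX⟩,
      hedgePayoff_of_le h hA ht (level_pos hw₀ t ω) (add_le_of_nonpos_left hX)]
    ring
  · exact hsurviving (mem_alive_succ.2 ⟨hω, hX⟩)

theorem valueProcess_eq_hedgeValue_of_succ (hA : ∀ t, 1 ≤ t → t < N → 0 < A t) (hw₀ : 0 < w₀)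
    (hS0 : ∀ᵐ ω ∂Q, 0 < S 0 ω) (ht : t < N)
    (hnext : ∀ᵐ ω ∂Q, ω ∈ alive S A N x₀ w₀ t →
      valueProcess Q ℱ S A N x₀ w₀ (t + 1) ω = hedgePayoff κ A N t (level S A N x₀ w₀ t ω)
        (fund S A N x₀ w₀ (t + 1) ω + level S A N x₀ w₀ t ω)) :
    ∀ᵐ ω ∂Q, ω ∈ alive S A N x₀ w₀ t → valueProcess Q ℱ S A N x₀ w₀ t ω =
      hedgeValue κ A N t (level S A N x₀ w₀ t ω) (fund S A N x₀ w₀ t ω) := by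
  have halive := measurableSet_alive (A := A) (N := N) (x₀ := x₀) (w₀ := w₀) hS t
  have hvalue : Integrable (valueProcess Q ℱ S A N x₀ w₀ (t + 1)) Q := integrable_condExp
  have hi : Integrable ((alive S A N x₀ w₀ t).indicator fun ω =>
      hedgePayoff κ A N t (level S A N x₀ w₀ t ω)
        (fund S A N x₀ w₀ (t + 1) ω + level S A N x₀ w₀ t ω)) Q := by
    refine (hvalue.indicator (ℱ.le t _ halive)).congr ?_
    filter_upwards [hnext] with ω hω
    by_cases hmem : ω ∈ alive S A N x₀ w₀ t
    · simp only [indicator_of_mem hmem, hω hmem]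
    · simp only [indicator_of_notMem hmem]
  have hreplace := condExp_eq_on_of_ae_eq halive hvalue hi
    (hnext.mono fun ω hω hmem => by rw [indicator_of_mem hmem, hω hmem])
  filter_upwards [valueProcess_eq_condExp_succ hA1 hS h (hS0.mono fun _ => le_of_lt) ht, hreplace,
    condExp_indicator_hedgePayoff_eq_hedgeValue hA1 hS h hA hw₀ hS0 ht hi]
    with ω htower hreplace hmarkov hω
  rw [htower hω, hreplace hω, hmarkov hω]

theorem valueProcess_eq_hedge (hA : ∀ t, 1 ≤ t → t < N → 0 < A t) (hw₀ : 0 < w₀)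
    (hS0 : ∀ᵐ ω ∂Q, 0 < S 0 ω) : ∀ t < N, ∀ᵐ ω ∂Q, (t : ℕ∞) < depletionTime S A N x₀ w₀ ω →
      valueProcess Q ℱ S A N x₀ w₀ t ω =
        hedgeValue κ A N t (level S A N x₀ w₀ t ω) (fund S A N x₀ w₀ t ω) ∧
      valueProcess Q ℱ S A N x₀ w₀ (t + 1) ω = hedgePayoff κ A N t (level S A N x₀ w₀ t ω)
        (fund S A N x₀ w₀ (t + 1) ω + level S A N x₀ w₀ t ω) := by
  refine backward_induction fun t ht ih => ?_
  have hnext := valueProcess_succ_eq_hedgePayoff (x₀ := x₀) hA1 hS h hA hw₀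
    (hS0.mono fun _ => le_of_lt) ht fun htN => (ih htN).mono fun ω hω halive =>
      (hω ((lt_depletionTime_iff htN.le).2 halive)).1
  filter_upwards [valueProcess_eq_hedgeValue_of_succ hA1 hS h hA hw₀ hS0 ht hnext, hnext]
    with ω hcurrent hnext hτ
  rw [lt_depletionTime_iff ht.le] at hτ
  exact ⟨hcurrent hτ, hnext hτ⟩

end ValueProcess

end RollUp

theorem mainTheorem7 {Ω : Type*} {m : MeasurableSpace Ω} (Q : Measure Ω) [IsProbabilityMeasure Q]
    (ℱ : Filtration ℕ m) (S : ℕ → Ω → ℝ) (κ : ℕ → Kernel ℝ ℝ) [∀ t, IsMarkovKernel (κ t)]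
    (N : ℕ) (A : ℕ → ℝ) (x₀ w₀ : ℝ)
    (hS : Martingale S ℱ Q) (hS0 : ∀ᵐ ω ∂Q, S 0 ω = 1)
    (hA1 : RollUp.AssumptionA1 Q ℱ S κ N) (hA2 : RollUp.AssumptionA2 κ N)
    (hA : ∀ t, 1 ≤ t → t < N → 0 < A t) (hx₀ : 0 < x₀) (hw₀ : 0 < w₀) :
    -- the option sensitivities in the recursions exist (the Gamma almost everywhere)
    (∀ t < N, ∀ K, 0 < K →
      (∀ x, 0 < x → DifferentiableAt ℝ (RollUp.put κ t K) x ∧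
        DifferentiableAt ℝ (RollUp.call κ t K) x) ∧
      ∀ᵐ x ∂(volume.restrict (Set.Ioi (0 : ℝ))), DifferentiableAt ℝ (RollUp.putDelta κ t K) x) ∧
    -- the integrals against the weight functions exist
    (∀ t < N,
      IntegrableOn (RollUp.weights κ A N t).g (Set.Icc 1 (1 + A (t + 1))) ∧
      (∀ w, 0 < w → ∀ x, 0 < x →
        IntegrableOn (fun k => RollUp.put κ t (w * k) x * (RollUp.weights κ A N t).g k)
          (Set.Icc 1 (1 + A (t + 1))) ∧
        IntegrableOn (fun k => RollUp.putDelta κ t (w * k) x * (RollUp.weights κ A N t).g k)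
          (Set.Icc 1 (1 + A (t + 1)))) ∧
      ∀ᵐ x ∂(volume.restrict (Set.Ioi (0 : ℝ))),
        IntegrableOn (fun k => RollUp.gamma κ t k x * (RollUp.weights κ A N t).g k)
          (Set.Icc 1 (1 + A (t + 1)))) ∧
    -- the value function is given by the hedge portfolio, whatever the asset price `s`
    (∀ t < N, ∀ w, 0 < w → ∀ x, 0 < x → ∀ s, 0 < s →
      Integrable (fun y => RollUp.valueFun κ A N (t + 1) w (x * (y / s) - w) y) (κ t s) ∧
      RollUp.valueBar κ A N t w x s = RollUp.hedgeValue κ A N t w x) ∧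
    -- positive homogeneity
    (∀ t < N, ∀ c, 0 < c → ∀ w, 0 < w → ∀ x, 0 < x → ∀ s, 0 < s →
      RollUp.valueBar κ A N t (c * w) (c * x) s = c * RollUp.valueBar κ A N t w x s) ∧
    -- replication, at every fund value `y` before the withdrawal at date `t + 1`
    (∀ t < N, ∀ w, 0 < w → ∀ y, 0 ≤ y → ∀ s, 0 < s →
      RollUp.hedgePayoff κ A N t w y = RollUp.valueFun κ A N (t + 1) w (y - w) s) ∧
    -- the value process of the guarantee, and its semi-static hedge along the fund
    (∀ t ≤ N, Integrable (RollUp.claim S A N x₀ w₀ t) Q) ∧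
    (∀ t < N, ∀ᵐ ω ∂Q, (t : ℕ∞) < RollUp.depletionTime S A N x₀ w₀ ω →
      RollUp.valueProcess Q ℱ S A N x₀ w₀ t ω =
        RollUp.hedgeValue κ A N t (RollUp.level S A N x₀ w₀ t ω) (RollUp.fund S A N x₀ w₀ t ω) ∧
      RollUp.valueProcess Q ℱ S A N x₀ w₀ (t + 1) ω =
        RollUp.hedgePayoff κ A N t (RollUp.level S A N x₀ w₀ t ω)
          (RollUp.fund S A N x₀ w₀ (t + 1) ω + RollUp.level S A N x₀ w₀ t ω)) := by
  have hadapted := hS.1.adapted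
  have hS0pos : ∀ᵐ ω ∂Q, 0 < S 0 ω := hS0.mono fun ω hω => hω ▸ one_pos
  have hmean : 0 < ∫ ω, S 0 ω ∂Q := by simp [integral_congr_ae hS0]
  have h t (ht : t < N) := hA1.isScaling hA2 hS hmean ht
  refine ⟨fun t ht K hK => ⟨fun x hx => ⟨?_, ?_⟩, (h t ht).ae_differentiableAt_putDelta hK⟩,
    fun t ht => ⟨RollUp.integrableOn_weights_g h hA t ht, fun w hw x hx =>
      ⟨RollUp.integrableOn_put_mul_weights_g h hA ht hx w,
        RollUp.integrableOn_putDelta_mul_weights_g h hA ht hw hx⟩,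
      RollUp.ae_integrableOn_gamma_mul_weights_g h hA ht⟩,
    fun t ht w hw x hx s hs => ⟨RollUp.integrable_valueFun h hA ht hw x hs,
      RollUp.valueBar_eq_hedgeValue h hA ht hw hx hs⟩,
    fun t ht c hc w hw x hx s hs => RollUp.valueBar_mul h hA ht hc hw hx hs,
    fun t ht w hw y _ s hs => RollUp.hedgePayoff_eq_valueFun h hA t ht w hw y s (.inl hs),
    fun t ht => RollUp.integrable_claim hA1 hadapted h (hS0pos.mono fun _ => le_of_lt) ht,
    RollUp.valueProcess_eq_hedge hA1 hadapted h hA hw₀ hS0pos⟩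
  · exact ((h t ht).hasDerivAt_put hK hx).differentiableAt
  · exact ((h t ht).hasDerivAt_call hK hx).differentiableAt
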